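/- **Setting.** Let $\mathfrak g$ be a finite-dimensional semisimple complex Lie algebra with basis $(I^a)$, and let $\kappa$ be the opposite of its Killing form. Let $\Sigma$ be a finite set of sites; each $\alpha\in\Sigma$ has a multiplicity $m_\alpha\ge 1$, a position $z_\alpha\in\mathbb C$ (pairwise distinct) and levels $\ell^\alpha_p\in\mathbb C$, $0\le p<m_\alpha$, with $\ell^\alpha_{m_\alpha-1}\neq 0$. Local fields form a commutative differential algebra $(\mathcal V,\partial_x)$ with a local Poisson bracket (a Poisson vertex algebra): $\{a(y),b(x)\}=\sum_{n}c_n(x)\,\partial_x^n\delta(x-y)$ (finite sum, $c_n\in\mathcal V$), skew-symmetric and satisfying the Leibniz and Jacobi identities. Local functionals $\int a\,\mathrm dx$ are classes of local fields modulo total derivatives. A constrained realisation of the affine Gaudin model consists of $\mathfrak g$-valued fields $\mathcal J^\alpha_p\in\mathcal V\otimes\mathfrak g$ with $$\{\mathcal J^\alpha_p{}_{\,\mathbf 1}(x),\mathcal J^\beta_q{}_{\,\mathbf 2}(y)\}=\delta_{\alpha\beta}\bigl([C_{\mathbf{12}},\mathcal J^\alpha_{p+q}{}_{\,\mathbf 1}(x)]\,\delta(x-y)-\ell^\alpha_{p+q}\,C_{\mathbf{12}}\,\partial_x\delta(x-y)\bigr)$$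 (zero if $p+q\ge m_\alpha$), where $C_{\mathbf{12}}$ is the split Casimir of $\kappa$. Put $$\Gamma(z)=\sum_{\alpha,p}\frac{\mathcal J^\alpha_p}{(z-z_\alpha)^{p+1}},\qquad \varphi(z)=\sum_{\alpha,p}\frac{\ell^\alpha_p}{(z-z_\alpha)^{p+1}},\qquad \chi(u)=-\frac1{u^2}\varphi\Bigl(\frac1u\Bigr),\qquad \mathcal L(z)=\frac{\Gamma(z)}{\varphi(z)},$$ and define $\mathcal C,\mathcal B,\mathcal B_1$ by $\Gamma(1/u)=u\,\mathcal C-u^2\mathcal B-u^3\mathcal B_1+O(u^4)$. The constraints are the components $\mathcal C^a=\kappa(I^a,\mathcal C)$; $F\approx G$ means that $F$ and $G$ are equal modulo the ideal generated by all $\partial_x^k\mathcal C^a$. Assume that the 1-form $\varphi(z)\,\mathrm dz$ on $\mathbb P^1$ is regular at infinity and that all its zeroes $\zeta_1,\dots,\zeta_M\in\mathbb P^1$ are simple. Let $$\mathcal Q(z)=-\frac1{2\varphi(z)}\int\kappa(\Gamma(z,x),\Gamma(z,x))\,\mathrm dx,\qquad \mathcal Q_i=\operatorname*{res}_{z=\zeta_i}\mathcal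 Q(z)\,\mathrm dz,\qquad \mathcal H_0=\sum_{i=1}^M\epsilon_i\mathcal Q_i,$$ with arbitrary constants $\epsilon_i$. Let $\mu=\sum_a\mu_aI^a$ be a $\mathfrak g$-valued Lagrange multiplier, its components lying in a commutative differential algebra to which $\mathcal V$ maps by a homomorphism of differential algebras. The time evolution of $\mathcal O\in\mathcal V$ is given by the total Hamiltonian $\mathcal H=\mathcal H_0+\int\kappa(\mu,\mathcal C)\,\mathrm dx$, that is, $$\{\mathcal H,\mathcal O\}:=\{\mathcal H_0,\mathcal O\}+\sum_a\int\mu_a(y)\{\mathcal C^a(y),\mathcal O\}\,\mathrm dy ,\qquad \partial_t\mathcal O\approx\{\mathcal H,\mathcal O\}.$$ **Theorem.** There is a $\mathfrak g$-valued field $\mathcal M(z,x)$ such that for all $z\in\mathbb C\setminus\{\zeta_1,\dots,\zeta_M\}$ (including $z=z_\alpha$, where $\mathcal L$ is regular) $$\{\mathcal H,\mathcal L(z)\}-\partial_x\mathcal M(z)+[\mathcal M(z),\mathcal L(z)]=0 ,$$ and therefore $\partial_t\mathcal L(z)-\partial_x\mathcal M(z)+[\mathcal M(z),\mathcal L(z)]\approx0$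 for every derivation $\partial_t$ with $\partial_t\mathcal O\approx\{\mathcal H,\mathcal O\}$ for all $\mathcal O\in\mathcal V$. Moreover, for these $z$: (i) If $\varphi(z)\,\mathrm dz$ is non-zero at infinity, then $$\mathcal L(z)\approx\sum_{i=1}^M\frac{1}{\varphi'(\zeta_i)}\frac{\Gamma(\zeta_i)}{z-\zeta_i}+\frac{\mathcal B}{\chi(0)},\qquad \mathcal M(z)=\sum_{i=1}^M\frac{\epsilon_i}{\varphi'(\zeta_i)}\frac{\Gamma(\zeta_i)}{z-\zeta_i}+\mu .$$ (ii) If $\varphi(z)\,\mathrm dz$ has a simple zero at infinity, labelled $\zeta_M=\infty$, then $$\mathcal L(z)\approx\sum_{i=1}^{M-1}\frac{1}{\varphi'(\zeta_i)}\frac{\Gamma(\zeta_i)}{z-\zeta_i}+\frac{\mathcal B}{\chi'(0)}z+\frac{2\chi'(0)\mathcal B_1-\chi''(0)\mathcal B}{2\chi'(0)^2},$$ $$\mathcal M(z)\approx\sum_{i=1}^{M-1}\frac{\epsilon_i}{\varphi'(\zeta_i)}\frac{\Gamma(\zeta_i)}{z-\zeta_i}+\epsilon_M\left(\frac{\mathcal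 B}{\chi'(0)}z+\frac{2\chi'(0)\mathcal B_1-\chi''(0)\mathcal B}{2\chi'(0)^2}\right)+\mu .$$ -/

import Mathlib

noncomputable section

namespace Gaudin

open scoped TensorProduct
open Polynomial (X C)

/-! ### Local field theories: differential algebras with a local Poisson bracket -/

/-- The algebra `V` of local fields of a Hamiltonian field theory in one space dimension.  It is a
commutative complex algebra with the space derivative `∂` and with a local Poisson bracket; that
is, a Poisson vertex algebra.  The equal-time bracket
`{a(y), b(x)} = ∑ₙ cₙ(x) ∂ₓⁿ δ(x - y)` of two local fields is recorded as the polynomial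
`bracket a b = ∑ₙ cₙ λⁿ` (the λ-bracket `{a_λ b}`).  The fields of the structure are what
bilinearity, compatibility with `∂ₓ` and `∂_y`, skew-symmetry, the Leibniz rule and the Jacobi
identity of the Poisson bracket say about the coefficients `cₙ`. -/
structure LocalPoissonAlgebra (V : Type*) [CommRing V] [Algebra ℂ V] where
  /-- The space derivative `∂ = ∂ₓ`. -/
  der : Derivation ℂ V V
  /-- The λ-bracket `{a_λ b}`, a polynomial in `λ = X` with coefficients in `V`. -/
  bracket : V →ₗ[ℂ] V →ₗ[ℂ] Polynomial V
  /-- `{∂a_λ b} = -λ {a_λ b}`. -/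
  bracket_der_left : ∀ a b, bracket (der a) b = -(X * bracket a b)
  /-- `{a_λ ∂b} = (λ + ∂) {a_λ b}`. -/
  bracket_der_right : ∀ a b n,
    (bracket a (der b)).coeff n = (X * bracket a b).coeff n + der ((bracket a b).coeff n)
  /-- `{a_λ b} = -{b_{-λ-∂} a}`. -/
  bracket_skew : ∀ a b n, (bracket a b).coeff n =
    -(bracket b a).sum fun N c => ((-1 : ℂ) ^ N * (N.choose n : ℂ)) • der^[N - n] c
  /-- `{a_λ bc} = {a_λ b} c + b {a_λ c}`. -/
  bracket_mul : ∀ a b c, bracket a (b * c) = bracket a b * C c + C b * bracket a c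
  /-- `{a_λ {b_μ c}} - {b_μ {a_λ c}} = {{a_λ b}_{λ+μ} c}`, the coefficient of `λᵐ μⁿ`. -/
  bracket_jacobi : ∀ a b c m n,
    (bracket a ((bracket b c).coeff n)).coeff m - (bracket b ((bracket a c).coeff m)).coeff n =
      ∑ k ∈ Finset.range (m + 1),
        ((m + n - k).choose n : ℂ) • (bracket ((bracket a b).coeff k) c).coeff (m + n - k)

section LocalPoissonAlgebra

variable {V : Type*} [CommRing V] [Algebra ℂ V] (P : LocalPoissonAlgebra V)

/-- Local functionals `∫ dx a(x)`: local fields modulo total derivatives. -/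
abbrev LocalFunctional : Type _ := V ⧸ LinearMap.range (P.der : V →ₗ[ℂ] V)

/-- The local functional `∫ dx a(x)`. -/
def integral : V →ₗ[ℂ] LocalFunctional P := Submodule.mkQ _

/-- The Poisson bracket `{∫ dy a(y), b(x)}` of a local functional with a local field: the
coefficient of `λ⁰` in `{a_λ b}`. -/
def functionalBracket : LocalFunctional P →ₗ[ℂ] V →ₗ[ℂ] V :=
  Submodule.liftQ _
    (P.bracket.compr₂ ((Polynomial.lcoeff V 0).restrictScalars ℂ)) (by
      rintro _ ⟨a, rfl⟩
      ext b
      simp [P.bracket_der_left])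

variable {W : Type*} [CommRing W] [Algebra ℂ W] (dx : Derivation ℂ W W) (ι : V →ₐ[ℂ] W)

/-- `∫ dy w(y) {a(y), b(x)} = ∑ₙ cₙ(x) ∂ₓⁿ w(x)` as a function of `b`, where
`{a(y), b(x)} = ∑ₙ cₙ(x) ∂ₓⁿ δ(x - y)` and `w` lies in a differential algebra `W` to which `V`
is mapped by `ι`. -/
def smearedBracket (w : W) (a : V) : V →ₗ[ℂ] W :=
  (Polynomial.lsum fun n =>
    (LinearMap.mulLeft ℂ (dx^[n] w)).comp ι.toLinearMap).comp (P.bracket a)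

end LocalPoissonAlgebra

/-! ### Weak equality -/

/-- The ideal generated by the constraints `c a` and all their space derivatives. -/
def constraintIdeal {W : Type*} [CommRing W] [Algebra ℂ W] (dx : Derivation ℂ W W)
    {n : ℕ} (c : Fin n → W) : Ideal W :=
  Ideal.span {w | ∃ a k, w = dx^[k] (c a)}

/-- Two `𝔤`-valued fields are equal once the fields in the ideal `K` are set to zero. -/
def WeakEq {W 𝔤 : Type*} [CommRing W] [Algebra ℂ W] [AddCommGroup 𝔤] [Module ℂ 𝔤]
    (K : Ideal W) (F G : W ⊗[ℂ] 𝔤) : Prop :=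
  (Ideal.Quotient.mkₐ ℂ K).toLinearMap.rTensor 𝔤 F =
    (Ideal.Quotient.mkₐ ℂ K).toLinearMap.rTensor 𝔤 G

/-! ### Rational functions on the Riemann sphere -/

theorem taylor_nonZeroDivisors (w : ℂ) : nonZeroDivisors (Polynomial ℂ) ≤
    (nonZeroDivisors (Polynomial ℂ)).comap (Polynomial.taylorAlgHom w) := by
  intro p hp
  rw [mem_nonZeroDivisors_iff_ne_zero] at hp
  rw [Submonoid.mem_comap, mem_nonZeroDivisors_iff_ne_zero]
  intro h
  exact hp (Polynomial.taylor_injective w (by simpa using h))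

/-- The translation `f(z) ↦ f(z + w)` of rational functions. -/
def translate (w : ℂ) : RatFunc ℂ →ₐ[ℂ] RatFunc ℂ :=
  RatFunc.mapAlgHom (Polynomial.taylorAlgHom w) (taylor_nonZeroDivisors w)

/-- The inversion `f(z) ↦ f(1/u)` of rational functions. -/
def invert : RatFunc ℂ →ₐ[ℂ] RatFunc ℂ :=
  RatFunc.liftAlgHom (Polynomial.aeval (RatFunc.X : RatFunc ℂ)⁻¹) (by
    intro p hp
    rw [mem_nonZeroDivisors_iff_ne_zero] at hp
    rw [Submonoid.mem_comap, mem_nonZeroDivisors_iff_ne_zero]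
    intro h
    refine hp ?_
    have ht : Transcendental ℂ ((RatFunc.X : RatFunc ℂ)⁻¹) := fun ha =>
      RatFunc.transcendental_X (K := ℂ) (by simpa using ha.inv)
    exact (transcendental_iff.mp ht) p h)

open scoped RatFunc in
/-- The Laurent expansion of a rational function at the origin. -/
def expansionAtZero : RatFunc ℂ →+* LaurentSeries ℂ :=
  algebraMap (RatFunc ℂ) (LaurentSeries ℂ)

theorem expansionAtZero_algebraMap (q : Polynomial ℂ) :
    expansionAtZero (algebraMap (Polynomial ℂ) (RatFunc ℂ) q) =
      HahnSeries.ofPowerSeries ℤ ℂ (q : PowerSeries ℂ) := by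
  rw [expansionAtZero, ← IsScalarTower.algebraMap_apply]
  rfl

/-- The Laurent expansion of a rational function at a point of the Riemann sphere, in the local
coordinate `z - w` at a finite point `w` and in `u = 1/z` at infinity. -/
def expansion : OnePoint ℂ → (RatFunc ℂ →+* LaurentSeries ℂ)
  | OnePoint.infty => expansionAtZero.comp invert.toRingHom
  | OnePoint.some w => expansionAtZero.comp (translate w).toRingHom

theorem expansion_algebraMap (p : OnePoint ℂ) (c : ℂ) :
    expansion p (algebraMap ℂ (RatFunc ℂ) c) = HahnSeries.C c := by
  have h : expansionAtZero (algebraMap ℂ (RatFunc ℂ) c) = HahnSeries.C c := by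
    have h1 : algebraMap ℂ (RatFunc ℂ) c =
        algebraMap (Polynomial ℂ) (RatFunc ℂ) (Polynomial.C c) := rfl
    rw [h1, expansionAtZero_algebraMap, Polynomial.coe_C, HahnSeries.ofPowerSeries_C]
  induction p using OnePoint.rec with
  | infty =>
    change expansionAtZero (invert (algebraMap ℂ (RatFunc ℂ) c)) = _
    rw [AlgHom.commutes, h]
  | coe w =>
    change expansionAtZero (translate w (algebraMap ℂ (RatFunc ℂ) c)) = _
    rw [AlgHom.commutes, h]

/-- The `k`-th coefficient of the Laurent expansion at `p`. -/
def laurentCoeff (p : OnePoint ℂ) (k : ℤ) : RatFunc ℂ →ₗ[ℂ] ℂ where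
  toFun f := (expansion p f).coeff k
  map_add' f g := by simp
  map_smul' c f := by
    rw [Algebra.smul_def, map_mul, expansion_algebraMap, HahnSeries.C_mul_eq_smul,
      HahnSeries.coeff_smul, RingHom.id_apply]

/-- The value `f⁽ⁿ⁾(w)` of the `n`-th derivative of a rational function at a point `w` where it is
regular, read off from the Taylor expansion. -/
def derivAt (n : ℕ) (f : RatFunc ℂ) (w : ℂ) : ℂ :=
  (n.factorial : ℂ) * laurentCoeff (w : OnePoint ℂ) n f

/-- The function `χ(u) = -u⁻² φ(1/u)`, so that `φ(z) dz = χ(u) du` for `u = 1/z`. -/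
def chi (φ : RatFunc ℂ) : RatFunc ℂ := -(RatFunc.X ^ 2)⁻¹ * invert φ

/-- The order of the 1-form `φ(z) dz` at a point of the Riemann sphere: positive at a zero, negative
at a pole, `⊤` if `φ = 0`. -/
def formOrder (φ : RatFunc ℂ) : OnePoint ℂ → WithTop ℤ
  | OnePoint.infty => (expansion ((0 : ℂ) : OnePoint ℂ) (chi φ)).orderTop
  | OnePoint.some w => (expansion (w : OnePoint ℂ) φ).orderTop

section Valued

/-! Rational functions of `z` with values in a complex vector space `E` are elements of
`RatFunc ℂ ⊗ E`. -/

variable {E : Type*} [AddCommGroup E] [Module ℂ E]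

/-- The `k`-th Laurent coefficient at `p` of an `E`-valued rational function. -/
def valuedCoeff (p : OnePoint ℂ) (k : ℤ) : RatFunc ℂ ⊗[ℂ] E →ₗ[ℂ] E :=
  (TensorProduct.lid ℂ E).toLinearMap ∘ₗ (laurentCoeff p k).rTensor E

/-- The value `F(z)` of an `E`-valued rational function at a point `z` where it is regular (the
constant term of its expansion at `z`; removable singularities are removed). -/
def value (F : RatFunc ℂ ⊗[ℂ] E) (z : ℂ) : E := valuedCoeff (z : OnePoint ℂ) 0 F

/-- The residue of the 1-form `F(z) dz` at a point of the Riemann sphere.  At infinity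
`F(z) dz = -F(1/u) u⁻² du`. -/
def residue (F : RatFunc ℂ ⊗[ℂ] E) : OnePoint ℂ → E
  | OnePoint.infty => -valuedCoeff OnePoint.infty 1 F
  | OnePoint.some w => valuedCoeff (w : OnePoint ℂ) (-1) F

end Valued

/-- The constant term of the expansion at a regular point is the value of the function there. -/
theorem laurentCoeff_zero_eq_eval (f : RatFunc ℂ) (w : ℂ) (hw : f.denom.eval w ≠ 0) :
    laurentCoeff (w : OnePoint ℂ) 0 f = f.eval (RingHom.id ℂ) w := by
  have key : ∀ q : Polynomial ℂ, expansion (w : OnePoint ℂ) (algebraMap _ (RatFunc ℂ) q) =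
      HahnSeries.ofPowerSeries ℤ ℂ (Polynomial.taylor w q : PowerSeries ℂ) := by
    intro q
    have h1 : translate w (algebraMap _ (RatFunc ℂ) q) =
        algebraMap _ (RatFunc ℂ) (Polynomial.taylor w q) := by
      have := RatFunc.map_apply_div (Polynomial.taylorAlgHom w) (taylor_nonZeroDivisors w) q 1
      simp only [map_one, div_one] at this
      exact this
    change expansionAtZero (translate w (algebraMap _ (RatFunc ℂ) q)) = _
    rw [h1, expansionAtZero_algebraMap]
  set D : PowerSeries ℂ := (Polynomial.taylor w f.denom : PowerSeries ℂ) with hD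
  set N : PowerSeries ℂ := (Polynomial.taylor w f.num : PowerSeries ℂ) with hN
  have hc : ∀ q : Polynomial ℂ,
      PowerSeries.constantCoeff (Polynomial.taylor w q : PowerSeries ℂ) = q.eval w := by
    intro q
    simp [← PowerSeries.coeff_zero_eq_constantCoeff_apply]
  have hD0 : PowerSeries.constantCoeff D ≠ 0 := by rw [hD, hc]; exact hw
  have hdn : algebraMap (Polynomial ℂ) (RatFunc ℂ) f.denom ≠ 0 := by
    simpa using f.denom_ne_zero
  have hf : f * algebraMap _ (RatFunc ℂ) f.denom = algebraMap _ (RatFunc ℂ) f.num := by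
    conv_lhs => rw [← f.num_div_denom]
    field_simp
    simp
  have he : expansion (w : OnePoint ℂ) f * HahnSeries.ofPowerSeries ℤ ℂ D =
      HahnSeries.ofPowerSeries ℤ ℂ N := by
    rw [hD, hN, ← key, ← key, ← map_mul, hf]
  have hinv : D * D⁻¹ = 1 := PowerSeries.mul_inv_cancel D hD0
  have he2 : expansion (w : OnePoint ℂ) f = HahnSeries.ofPowerSeries ℤ ℂ (N * D⁻¹) := by
    rw [map_mul, ← he, mul_assoc, ← map_mul, hinv, map_one, mul_one]
  change (expansion (w : OnePoint ℂ) f).coeff 0 = _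
  rw [he2]
  have h0 := LaurentSeries.coeff_coe_powerSeries (N * D⁻¹) 0
  rw [Nat.cast_zero] at h0
  rw [h0, PowerSeries.coeff_zero_eq_constantCoeff_apply, map_mul, PowerSeries.constantCoeff_inv,
    hN, hD, hc, hc, RatFunc.eval, div_eq_mul_inv]
  simp

/-! ### Affine Gaudin models -/

/-- The defining data of the sites: multiplicities, levels and positions.  The highest level of
each site is non-zero. -/
structure SiteData (S : Type*) where
  /-- The multiplicity `m_α ≥ 1`. -/
  mult : S → ℕ
  mult_pos : ∀ α, 0 < mult α
  /-- The levels `ℓ^α_p`, `p = 0, …, m_α - 1`. -/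
  level : ∀ α, Fin (mult α) → ℂ
  level_top_ne_zero : ∀ α, level α ⟨mult α - 1, Nat.sub_lt (mult_pos α) one_pos⟩ ≠ 0
  /-- The position `z_α`. -/
  pos : S → ℂ
  pos_injective : Function.Injective pos

section Model

variable {S : Type*} [Fintype S] (d : SiteData S)

/-- The rational function `1 / (z - z_α)^(p+1)`. -/
def polePart (α : S) (p : ℕ) : RatFunc ℂ :=
  ((RatFunc.X - RatFunc.C (d.pos α)) ^ (p + 1))⁻¹

/-- The twist function `φ(z) = ∑_α ∑_p ℓ^α_p / (z - z_α)^(p+1)`. -/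
def twist : RatFunc ℂ := ∑ α, ∑ p : Fin (d.mult α), d.level α p • polePart d α p

variable {V : Type*} [CommRing V] [Algebra ℂ V]
  {𝔤 : Type*} [LieRing 𝔤] [LieAlgebra ℂ 𝔤]

/-- `κ`, the opposite of the Killing form, extended bilinearly to `𝔤`-valued fields. -/
def kappa : LinearMap.BilinForm V (V ⊗[ℂ] 𝔤) :=
  LinearMap.BilinForm.baseChange V (-killingForm ℂ 𝔤)

/-- The component `κ(A, Y)` of a `𝔤`-valued field `A` along `Y ∈ 𝔤`. -/
def component (Y : 𝔤) (A : V ⊗[ℂ] 𝔤) : V := kappa A (1 ⊗ₜ[ℂ] Y)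

/-- Takiff currents `J^α_p` in the local field theory `P`, that is, a realisation of the Takiff
algebra with the given levels.  Contracting both tensor factors of
`{J^α_p(x)₁, J^β_q(y)₂} = δ_αβ ([C₁₂, J^α_{p+q}(x)₁] δ(x-y) - ℓ^α_{p+q} C₁₂ ∂ₓδ(x-y))`
(zero for `p + q ≥ m_α`) with `Y, Z ∈ 𝔤` by means of `κ`, it reads
`{κ(J^α_p(x), Y), κ(J^β_q(y), Z)} =
  δ_αβ (κ(J^α_{p+q}(y), [Y, Z]) δ(y-x) + ℓ^α_{p+q} κ(Y, Z) ∂_yδ(y-x))`. -/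
structure TakiffRealisation (P : LocalPoissonAlgebra V) (𝔤 : Type*) [LieRing 𝔤]
    [LieAlgebra ℂ 𝔤] where
  /-- The current `J^α_p`. -/
  current : ∀ α, Fin (d.mult α) → V ⊗[ℂ] 𝔤
  bracket_same_site : ∀ (α : S) (p q : Fin (d.mult α)) (Y Z : 𝔤),
    P.bracket (component Y (current α p)) (component Z (current α q)) =
      if h : (p : ℕ) + q < d.mult α then
        C (component ⁅Y, Z⁆ (current α ⟨p + q, h⟩)) +
          C (algebraMap ℂ V (d.level α ⟨p + q, h⟩ * -killingForm ℂ 𝔤 Y Z)) * X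
      else 0
  bracket_distinct_sites : ∀ (α β : S) (p : Fin (d.mult α)) (q : Fin (d.mult β)) (Y Z : 𝔤),
    α ≠ β → P.bracket (component Y (current α p)) (component Z (current β q)) = 0

variable {d} {P : LocalPoissonAlgebra V} (R : TakiffRealisation d P 𝔤)

namespace TakiffRealisation

/-- The Gaudin Lax matrix `Γ(z) = ∑_α ∑_p J^α_p / (z - z_α)^(p+1)`. -/
def gaudinLax : RatFunc ℂ ⊗[ℂ] (V ⊗[ℂ] 𝔤) :=
  ∑ α, ∑ p : Fin (d.mult α), polePart d α p ⊗ₜ[ℂ] R.current α p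

/-- The constraint `𝒞 = -res_{z=∞} Γ(z) dz`, also the coefficient of `u` in `Γ(1/u)`. -/
def constraint : V ⊗[ℂ] 𝔤 := -residue R.gaudinLax OnePoint.infty

/-- The current `ℬ`, defined by `Γ(1/u) = u 𝒞 - u² ℬ - u³ ℬ₁ + O(u⁴)`. -/
def currentB : V ⊗[ℂ] 𝔤 := -valuedCoeff OnePoint.infty 2 R.gaudinLax

/-- The current `ℬ₁`, defined by `Γ(1/u) = u 𝒞 - u² ℬ - u³ ℬ₁ + O(u⁴)`. -/
def currentB₁ : V ⊗[ℂ] 𝔤 := -valuedCoeff OnePoint.infty 3 R.gaudinLax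

/-- The components `𝒞^a = κ(I^a, 𝒞)` of the constraint in a basis `I` of `𝔤`. -/
def constraintComponent {n : ℕ} (I : Module.Basis (Fin n) ℂ 𝔤) (a : Fin n) : V :=
  component (I a) R.constraint

/-- The bilinear map `(A, B) ↦ ∫ dx κ(A(x), B(x))` on `𝔤`-valued fields. -/
def integralKappa (P : LocalPoissonAlgebra V) :
    V ⊗[ℂ] 𝔤 →ₗ[ℂ] V ⊗[ℂ] 𝔤 →ₗ[ℂ] LocalFunctional P :=
  (LinearMap.restrictScalars₁₂ ℂ ℂ (kappa (V := V) (𝔤 := 𝔤))).compr₂ (integral P)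

/-- The quadratic charge `𝒬(z) = -1/(2φ(z)) ∫ dx κ(Γ(z,x), Γ(z,x))`. -/
def quadraticCharge : RatFunc ℂ ⊗[ℂ] LocalFunctional P :=
  (-(2 * twist d)⁻¹) •
    TensorProduct.map₂ (LinearMap.mul ℂ (RatFunc ℂ)) (integralKappa P) R.gaudinLax R.gaudinLax

/-- The Lax matrix `ℒ(z) = Γ(z) / φ(z)`. -/
def lax : RatFunc ℂ ⊗[ℂ] (V ⊗[ℂ] 𝔤) := (twist d)⁻¹ • R.gaudinLax

/-- The term `Γ(ζ) / (φ'(ζ) (z - ζ))` attached to a finite zero `ζ` of the twist function; it is set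
to zero for `ζ = ∞`, so that sums over all zeroes run over the finite ones only. -/
def poleTerm (z : ℂ) : OnePoint ℂ → V ⊗[ℂ] 𝔤
  | OnePoint.infty => 0
  | OnePoint.some ζ => (derivAt 1 (twist d) ζ * (z - ζ))⁻¹ • value R.gaudinLax ζ

/-- The first-class Hamiltonian `ℋ₀ = ∑ᵢ εᵢ 𝒬ᵢ`, where `𝒬ᵢ = res_{z=ζᵢ} 𝒬(z) dz`. -/
def hamiltonian {M : ℕ} (ζ : Fin M → OnePoint ℂ) (ε : Fin M → ℂ) : LocalFunctional P :=
  ∑ i, ε i • residue R.quadraticCharge (ζ i)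

/-- The time evolution `𝒪 ↦ {ℋ₀, 𝒪} + ∫ dy μ_a(y) {𝒞^a(y), 𝒪}` generated by the total Hamiltonian
`ℋ = ℋ₀ + ∫ dy κ(μ(y), 𝒞(y))`, where `μ = μ_a I^a`.  The Lagrange multipliers `μ_a` and the
result lie in a differential algebra `W` to which the algebra of fields is mapped by `ι`. -/
def timeEvolution {W : Type*} [CommRing W] [Algebra ℂ W] (dx : Derivation ℂ W W)
    (ι : V →ₐ[ℂ] W) {n : ℕ} (I : Module.Basis (Fin n) ℂ 𝔤) (μ : Fin n → W)
    (H₀ : LocalFunctional P) : V →ₗ[ℂ] W :=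
  ι.toLinearMap ∘ₗ functionalBracket P H₀ +
    ∑ a, smearedBracket P dx ι (μ a) (R.constraintComponent I a)

end TakiffRealisation

/-- The left-hand side `E(ℒ) - ∂ₓ m + [m, ℒ]` of the zero curvature equation, where `E : V → W` gives
the time derivatives of the local fields. -/
def curvature {W : Type*} [CommRing W] [Algebra ℂ W] (dx : Derivation ℂ W W) (ι : V →ₐ[ℂ] W)
    (E : V →ₗ[ℂ] W) (m : W ⊗[ℂ] 𝔤) (ℒ : V ⊗[ℂ] 𝔤) : W ⊗[ℂ] 𝔤 :=
  E.rTensor 𝔤 ℒ - (dx : W →ₗ[ℂ] W).rTensor 𝔤 m + ⁅m, ι.toLinearMap.rTensor 𝔤 ℒ⁆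

end Model

end Gaudin

end

noncomputable section

namespace Gaudin

open scoped TensorProduct RatFunc

/-! ### Leading coefficients of Laurent series -/

/-! Fix a point `w` that is not a zero of `φ` and write `ℒ(w) = ∑ b_k J_k`, the index `k` running
over pairs of a site and an order, with `g_k(z)` the corresponding pole part. The Takiff bracket is
multiplication in truncated polynomial algebras, one per site. Contracting its products with the
`b_k` therefore gives, in the variable `z`, `(ℒ(w) - Γ(z)/φ(w)) / (z - w)` for the currents and `(1
- φ(z)/φ(w)) / (z - w)` for the levels (`sum_polePart_mul_laxCoeff`,
`sum_sum_laxCoeff_siteProduct`).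

Let `p` be a zero of `φ dz`. The two factors of `Γ` in the quadratic charge contribute equally,
cancelling the factor `1/2`, so `{𝒬_p, ℒ(w)}` is a residue at `p` built from these two expressions.
The term with `[Γ(z), Γ(z)]` vanishes by antisymmetry. In the term with `φ(z)/φ(w)` the denominator
`φ(z)` cancels, leaving `∂Γ(z)/(z - w)`, which has no residue at `p`. What remains is `∂N + [ℒ(w),
N]` with `N = -res_p ℒ(z) dz/(z - w)`, called `residueLax`; this is
`functionalBracket_residue_quadraticCharge`.

The constraint is the sum of the order-zero currents, the units of the truncated algebras, so
smearing it with `μ` generates gauge transformations `J_k ↦ ℓ_k ∂μ + [J_k, μ]`. Since `∑ b_k ℓ_k` is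
the value of `φ/φ = 1`, it acts on `ℒ(w)` as `∂μ + [ℒ(w), μ]`. Hence `ℳ = ∑ εᵢ Nᵢ + μ` solves the
zero curvature equation exactly; constraints enter only through the time derivative and the explicit
formulas.

Those formulas are partial fractions. Away from the zeroes `ℒ` is regular, even at the sites, where
`1/φ` has a zero of order `m_α`. A finite simple zero gives `Γ(ζ)/(φ'(ζ)(w - ζ))` both as polar part
of `ℒ` and as `N`; a zero at infinity gives as `N` the polynomial part of `ℒ`. Expanding `1/φ` in `u
= 1/z` writes this part through `ℬ`, `ℬ₁` and a multiple of `𝒞`, which is weakly zero. -/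

/-- All coefficients of `x` of degree less than `n` vanish. -/
def VanishesBelow (n : ℤ) (x : LaurentSeries ℂ) : Prop := ∀ k < n, x.coeff k = 0

namespace VanishesBelow

theorem mono {m n : ℤ} {x : LaurentSeries ℂ} (h : VanishesBelow n x) (hmn : m ≤ n) :
    VanishesBelow m x := fun k hk => h k (hk.trans_le hmn)

theorem sub {n : ℤ} {x y : LaurentSeries ℂ} (hx : VanishesBelow n x) (hy : VanishesBelow n y) :
    VanishesBelow n (x - y) := fun k hk => by simp [hx k hk, hy k hk]

theorem sum {ι : Type*} {s : Finset ι} {n : ℤ} {x : ι → LaurentSeries ℂ}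
    (hx : ∀ i ∈ s, VanishesBelow n (x i)) : VanishesBelow n (∑ i ∈ s, x i) := fun k hk => by
  rw [HahnSeries.coeff_sum]
  exact Finset.sum_eq_zero fun i hi => hx i hi k hk

theorem coeff_single_mul_ofPowerSeries (n : ℤ) (q : PowerSeries ℂ) (k : ℕ) :
    (HahnSeries.single n (1 : ℂ) * HahnSeries.ofPowerSeries ℤ ℂ q).coeff (n + k) =
      PowerSeries.coeff k q := by
  rw [add_comm, HahnSeries.coeff_single_mul_add, one_mul, LaurentSeries.coeff_coe_powerSeries]

theorem ofPowerSeries (q : PowerSeries ℂ) : VanishesBelow 0 (HahnSeries.ofPowerSeries ℤ ℂ q) := by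
  intro k hk
  rw [HahnSeries.ofPowerSeries_apply]
  refine HahnSeries.embDomain_of_notMem_range ?_
  rintro ⟨m, rfl⟩
  exact absurd hk (not_lt.mpr (Int.natCast_nonneg m))

theorem single_mul (n : ℤ) (q : PowerSeries ℂ) :
    VanishesBelow n (HahnSeries.single n (1 : ℂ) * HahnSeries.ofPowerSeries ℤ ℂ q) := by
  intro k hk
  rw [HahnSeries.coeff_single_mul, ofPowerSeries q _ (by omega), mul_zero]

/-- Factoring out a power of the variable reduces products of Laurent series to Cauchy products of
power series. -/
theorem exists_eq {n : ℤ} {x : LaurentSeries ℂ} (h : VanishesBelow n x) :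
    ∃ q : PowerSeries ℂ, x = HahnSeries.single n (1 : ℂ) * HahnSeries.ofPowerSeries ℤ ℂ q := by
  refine ⟨PowerSeries.mk fun k => x.coeff (n + k), ?_⟩
  ext k
  rcases lt_or_ge k n with hk | hk
  · rw [h k hk, single_mul n _ k hk]
  · obtain ⟨m, rfl⟩ := Int.le.dest hk
    rw [coeff_single_mul_ofPowerSeries, PowerSeries.coeff_mk]

variable {m n : ℤ} {x y : LaurentSeries ℂ} (hx : VanishesBelow m x) (hy : VanishesBelow n y)

include hx hy

theorem coeff_mul_nat (k : ℕ) : (x * y).coeff (m + n + k) =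
    ∑ ij ∈ Finset.HasAntidiagonal.antidiagonal k, x.coeff (m + ij.1) * y.coeff (n + ij.2) := by
  obtain ⟨p, rfl⟩ := hx.exists_eq
  obtain ⟨q, rfl⟩ := hy.exists_eq
  have : HahnSeries.single m (1 : ℂ) * HahnSeries.ofPowerSeries ℤ ℂ p *
      (HahnSeries.single n (1 : ℂ) * HahnSeries.ofPowerSeries ℤ ℂ q) =
      HahnSeries.single (m + n) (1 : ℂ) * HahnSeries.ofPowerSeries ℤ ℂ (p * q) := by
    rw [map_mul, mul_mul_mul_comm, HahnSeries.single_mul_single, one_mul]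
  rw [this, coeff_single_mul_ofPowerSeries, PowerSeries.coeff_mul]
  simp only [coeff_single_mul_ofPowerSeries]

theorem mul : VanishesBelow (m + n) (x * y) := by
  obtain ⟨p, rfl⟩ := hx.exists_eq
  obtain ⟨q, rfl⟩ := hy.exists_eq
  rw [mul_mul_mul_comm, HahnSeries.single_mul_single, one_mul, ← map_mul]
  exact single_mul _ _

theorem coeff_mul_zero : (x * y).coeff (m + n) = x.coeff m * y.coeff n := by
  simpa using coeff_mul_nat hx hy 0

theorem coeff_mul_one : (x * y).coeff (m + n + 1) =
    x.coeff m * y.coeff (n + 1) + x.coeff (m + 1) * y.coeff n := by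
  simpa [Finset.Nat.antidiagonal_succ] using coeff_mul_nat hx hy 1

theorem coeff_mul_two : (x * y).coeff (m + n + 2) =
    x.coeff m * y.coeff (n + 2) + x.coeff (m + 1) * y.coeff (n + 1) +
      x.coeff (m + 2) * y.coeff n := by
  have := coeff_mul_nat hx hy 2
  simp [Finset.Nat.antidiagonal_succ] at this
  rw [this]
  ring

end VanishesBelow

theorem vanishesBelow_single (n : ℤ) (a : ℂ) : VanishesBelow n (HahnSeries.single n a) :=
  fun _ hk => HahnSeries.coeff_single_of_ne hk.ne

/-- Orders add up under multiplication and `1` has order zero. Only an upper bound on the order of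
`x` is needed, and a single non-zero coefficient provides one. -/
theorem vanishesBelow_inv {n : ℤ} {x : LaurentSeries ℂ} (h0 : x ≠ 0) (h : x.orderTop ≤ n) :
    VanishesBelow (-n) x⁻¹ := by
  intro k hk
  have h1 := HahnSeries.order_mul h0 (inv_ne_zero h0)
  rw [mul_inv_cancel₀ h0, HahnSeries.order_one] at h1
  rw [← HahnSeries.order_eq_orderTop_of_ne_zero h0] at h
  have h2 : x.order ≤ n := WithTop.coe_le_coe.mp h
  exact HahnSeries.coeff_eq_zero_of_lt_order (by omega)

theorem vanishesBelow_of_le_orderTop {n : ℤ} {x : LaurentSeries ℂ} (h : n ≤ x.orderTop) :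
    VanishesBelow n x := fun _ hk =>
  HahnSeries.coeff_eq_zero_of_lt_orderTop (lt_of_lt_of_le (WithTop.coe_lt_coe.mpr hk) h)

theorem laurentCoeff_apply (p : OnePoint ℂ) (k : ℤ) (f : RatFunc ℂ) :
    laurentCoeff p k f = (expansion p f).coeff k := rfl

/-! ### Expansions of elementary rational functions -/

theorem translate_algebraMap (w : ℂ) (q : Polynomial ℂ) :
    translate w (algebraMap _ (RatFunc ℂ) q) =
      algebraMap _ (RatFunc ℂ) (Polynomial.taylor w q) := by
  have := RatFunc.map_apply_div (Polynomial.taylorAlgHom w) (taylor_nonZeroDivisors w) q 1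
  simp only [map_one, div_one] at this
  exact this

theorem expansion_coe_algebraMap (w : ℂ) (q : Polynomial ℂ) :
    expansion (w : OnePoint ℂ) (algebraMap _ (RatFunc ℂ) q) =
      HahnSeries.ofPowerSeries ℤ ℂ (Polynomial.taylor w q : PowerSeries ℂ) := by
  change expansionAtZero (translate w (algebraMap _ (RatFunc ℂ) q)) = _
  rw [translate_algebraMap, expansionAtZero_algebraMap]

theorem expansion_C (p : OnePoint ℂ) (c : ℂ) : expansion p (RatFunc.C c) = HahnSeries.C c := by
  rw [← expansion_algebraMap p c]
  rfl

theorem expansion_coe_X (w : ℂ) : expansion (w : OnePoint ℂ) RatFunc.X =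
    HahnSeries.single 1 1 + HahnSeries.C w := by
  rw [← RatFunc.algebraMap_X, expansion_coe_algebraMap, Polynomial.taylor_X]
  simp

theorem invert_algebraMap (q : Polynomial ℂ) : invert (algebraMap _ (RatFunc ℂ) q) =
    Polynomial.aeval (RatFunc.X : RatFunc ℂ)⁻¹ q := by
  rw [invert]
  have := RatFunc.liftAlgHom_apply_div (Polynomial.aeval (R := ℂ) (RatFunc.X : RatFunc ℂ)⁻¹) (by
    intro p hp
    rw [mem_nonZeroDivisors_iff_ne_zero] at hp
    rw [Submonoid.mem_comap, mem_nonZeroDivisors_iff_ne_zero]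
    intro h
    refine hp ?_
    have ht : Transcendental ℂ ((RatFunc.X : RatFunc ℂ)⁻¹) := fun ha =>
      RatFunc.transcendental_X (K := ℂ) (by simpa using ha.inv)
    exact (transcendental_iff.mp ht) p h) q 1
  simpa using this

theorem expansion_infty_X : expansion OnePoint.infty RatFunc.X = HahnSeries.single (-1) 1 := by
  change expansionAtZero (invert RatFunc.X) = _
  rw [← RatFunc.algebraMap_X, invert_algebraMap, Polynomial.aeval_X, map_inv₀, expansionAtZero,
    RatFunc.coe_X, HahnSeries.inv_single, inv_one]

theorem expansion_zero_eq : expansion ((0 : ℂ) : OnePoint ℂ) = expansionAtZero := by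
  refine RingHom.ext fun f => ?_
  change expansionAtZero (translate 0 f) = _
  congr 1
  rw [← RatFunc.num_div_denom f, map_div₀, translate_algebraMap, translate_algebraMap]
  simp

theorem expansion_chi (φ : RatFunc ℂ) : expansion ((0 : ℂ) : OnePoint ℂ) (chi φ) =
    HahnSeries.single (-2) (-1) * expansion OnePoint.infty φ := by
  rw [expansion_zero_eq, chi, map_mul, map_neg, map_inv₀, map_pow]
  change -((algebraMap (RatFunc ℂ) (LaurentSeries ℂ) RatFunc.X) ^ 2)⁻¹ * _ = _
  rw [RatFunc.coe_X, HahnSeries.single_pow, HahnSeries.inv_single]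
  simp
  rfl

/-- The factor `u⁻²` from `dz = -u⁻² du` shifts degrees by two. -/
theorem laurentCoeff_chi (φ : RatFunc ℂ) (k : ℤ) : laurentCoeff ((0 : ℂ) : OnePoint ℂ) k (chi φ) =
    -laurentCoeff OnePoint.infty (k + 2) φ := by
  rw [laurentCoeff_apply, laurentCoeff_apply, expansion_chi, HahnSeries.coeff_single_mul]
  simp

theorem laurentCoeff_infty_algebraMap (q : Polynomial ℂ) (k : ℕ) :
    laurentCoeff OnePoint.infty (-k) (algebraMap _ (RatFunc ℂ) q) = q.coeff k := by
  induction q using Polynomial.induction_on' with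
  | add p q hp hq => rw [map_add, map_add, hp, hq, Polynomial.coeff_add]
  | monomial n a =>
    change (expansion OnePoint.infty _).coeff _ = _
    rw [← Polynomial.C_mul_X_pow_eq_monomial, map_mul, map_pow, RatFunc.algebraMap_C,
      RatFunc.algebraMap_X, map_mul, map_pow, expansion_C, expansion_infty_X,
      HahnSeries.single_pow, HahnSeries.C_apply, HahnSeries.single_mul_single,
      Polynomial.C_mul_X_pow_eq_monomial, Polynomial.coeff_monomial, HahnSeries.coeff_single]
    simp [eq_comm]

/-- Geometric series: `1/(z - a) = u/(1 - a u)`. -/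
theorem expansion_infty_linear_inv (a : ℂ) :
    expansion OnePoint.infty (RatFunc.X - RatFunc.C a)⁻¹ = HahnSeries.single 1 (1 : ℂ) *
      HahnSeries.ofPowerSeries ℤ ℂ (PowerSeries.mk fun k => a ^ k) := by
  rw [map_inv₀, map_sub, expansion_infty_X, expansion_C]
  symm
  refine eq_inv_of_mul_eq_one_left ?_
  have h : (PowerSeries.mk fun k => a ^ k) * (1 - PowerSeries.C a * PowerSeries.X) = 1 := by
    ext k
    rw [mul_sub, mul_one, mul_left_comm, map_sub, PowerSeries.coeff_C_mul, PowerSeries.coeff_mk,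
      PowerSeries.coeff_one]
    rcases k with _ | k
    · simp
    · rw [PowerSeries.coeff_succ_mul_X, PowerSeries.coeff_mk]
      simp [pow_succ']
  have h1 : (HahnSeries.single (-1) 1 - HahnSeries.C a : LaurentSeries ℂ) =
      HahnSeries.single (-1) 1 *
        HahnSeries.ofPowerSeries ℤ ℂ (1 - PowerSeries.C a * PowerSeries.X) := by
    have h2 : HahnSeries.ofPowerSeries ℤ ℂ (1 - PowerSeries.C a * PowerSeries.X) =
        1 - HahnSeries.C a * HahnSeries.single 1 1 := by
      rw [map_sub, map_mul, HahnSeries.ofPowerSeries_C, HahnSeries.ofPowerSeries_X,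
        (HahnSeries.ofPowerSeries ℤ ℂ).map_one]
    rw [h2, mul_sub, mul_one, mul_left_comm, HahnSeries.single_mul_single]
    simp
  rw [h1, mul_mul_mul_comm, ← map_mul, h, HahnSeries.single_mul_single]
  simp

theorem expansion_coe_linear (w a : ℂ) :
    expansion (w : OnePoint ℂ) (RatFunc.X - RatFunc.C a) =
      HahnSeries.ofPowerSeries ℤ ℂ (PowerSeries.X + PowerSeries.C (w - a)) := by
  rw [map_sub, expansion_coe_X, expansion_C]
  simp only [map_add, map_sub, HahnSeries.ofPowerSeries_X, HahnSeries.ofPowerSeries_C]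
  ring

theorem expansion_coe_linear_self_inv (w : ℂ) :
    expansion (w : OnePoint ℂ) (RatFunc.X - RatFunc.C w)⁻¹ = HahnSeries.single (-1) 1 := by
  rw [map_inv₀, map_sub, expansion_coe_X, expansion_C, add_sub_cancel_right, HahnSeries.inv_single,
    inv_one]

theorem expansion_coe_linear_inv {w a : ℂ} (h : w ≠ a) :
    expansion (w : OnePoint ℂ) (RatFunc.X - RatFunc.C a)⁻¹ =
      HahnSeries.ofPowerSeries ℤ ℂ (PowerSeries.X + PowerSeries.C (w - a))⁻¹ := by
  rw [map_inv₀, expansion_coe_linear]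
  symm
  refine eq_inv_of_mul_eq_one_left ?_
  rw [← map_mul, PowerSeries.inv_mul_cancel, map_one]
  simpa [sub_eq_zero] using h

theorem vanishesBelow_linear_inv {w a : ℂ} (h : w ≠ a) :
    VanishesBelow 0 (expansion (w : OnePoint ℂ) (RatFunc.X - RatFunc.C a)⁻¹) := by
  rw [expansion_coe_linear_inv h]
  exact .ofPowerSeries _

theorem laurentCoeff_linear_inv {w a : ℂ} (h : w ≠ a) :
    laurentCoeff (w : OnePoint ℂ) 0 (RatFunc.X - RatFunc.C a)⁻¹ = (w - a)⁻¹ := by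
  change (expansion (w : OnePoint ℂ) _).coeff ((0 : ℕ) : ℤ) = _
  rw [expansion_coe_linear_inv h, LaurentSeries.coeff_coe_powerSeries]
  simp

theorem X_sub_C_ne_zero (a : ℂ) : (RatFunc.X - RatFunc.C a : RatFunc ℂ) ≠ 0 := by
  rw [← RatFunc.algebraMap_X, ← RatFunc.algebraMap_C, ← map_sub]
  exact (map_ne_zero_iff _ (RatFunc.algebraMap_injective ℂ)).mpr (Polynomial.X_sub_C_ne_zero a)

theorem expansion_ne_zero (p : OnePoint ℂ) {f : RatFunc ℂ} (h : f ≠ 0) : expansion p f ≠ 0 := by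
  simpa using h

/-- A rational function without finite poles is a polynomial. -/
theorem exists_polynomial_of_regular (f : RatFunc ℂ)
    (h : ∀ w : ℂ, VanishesBelow 0 (expansion (w : OnePoint ℂ) f)) :
    ∃ q : Polynomial ℂ, f = algebraMap _ (RatFunc ℂ) q := by
  have hd : f.denom.degree = 0 := by
    by_contra hne
    obtain ⟨w, hw⟩ := IsAlgClosed.exists_root f.denom hne
    -- Coprimality excludes a common root; comparing constant terms in `f * denom = num` at `w` then
    -- gives the contradiction.
    have hnum : f.num.eval w ≠ 0 := by
      intro hn
      obtain ⟨a, b, hab⟩ := RatFunc.isCoprime_num_denom f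
      have := congrArg (Polynomial.eval w) hab
      simp [hn, hw.eq_zero] at this
    have hf : f * algebraMap _ (RatFunc ℂ) f.denom = algebraMap _ (RatFunc ℂ) f.num := by
      have hdn : algebraMap (Polynomial ℂ) (RatFunc ℂ) f.denom ≠ 0 := by
        simpa using f.denom_ne_zero
      conv_lhs => rw [← f.num_div_denom]
      field_simp
      simp
    have hc : ∀ q : Polynomial ℂ,
        (expansion (w : OnePoint ℂ) (algebraMap _ (RatFunc ℂ) q)).coeff 0 = q.eval w := by
      intro q
      have := LaurentSeries.coeff_coe_powerSeries (Polynomial.taylor w q : PowerSeries ℂ) 0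
      rw [expansion_coe_algebraMap]
      simpa using this
    have hreg : VanishesBelow 0 (expansion (w : OnePoint ℂ)
        (algebraMap _ (RatFunc ℂ) f.denom)) := by
      rw [expansion_coe_algebraMap]
      exact .ofPowerSeries _
    have := (h w).coeff_mul_zero hreg
    rw [← map_mul, hf, add_zero, hc, hc, hw.eq_zero, mul_zero] at this
    exact hnum this
  have hd1 : f.denom = 1 := by
    have := Polynomial.eq_C_of_degree_eq_zero hd
    have hm := RatFunc.monic_denom f
    exact hm.natDegree_eq_zero.mp (Polynomial.natDegree_eq_of_degree_eq_some hd)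
  refine ⟨f.num, ?_⟩
  conv_lhs => rw [← f.num_div_denom, hd1]
  simp

/-! ### Residues and partial fractions of rational functions -/

/-- The residue of the 1-form `f(z) dz`. -/
def residueForm : OnePoint ℂ → RatFunc ℂ →ₗ[ℂ] ℂ
  | OnePoint.infty => -laurentCoeff OnePoint.infty 1
  | OnePoint.some w => laurentCoeff (w : OnePoint ℂ) (-1)

theorem residueForm_infty (f : RatFunc ℂ) :
    residueForm OnePoint.infty f = -(expansion OnePoint.infty f).coeff 1 := rfl

theorem residueForm_coe (w : ℂ) (f : RatFunc ℂ) :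
    residueForm (w : OnePoint ℂ) f = (expansion (w : OnePoint ℂ) f).coeff (-1) := rfl

/-- The term `res_ζ(f dz) / (w - ζ)` of the partial fraction decomposition of `f` at `w`; it is
zero for `ζ = ∞`. -/
def polarTerm (f : RatFunc ℂ) (w : ℂ) : OnePoint ℂ → ℂ
  | OnePoint.infty => 0
  | OnePoint.some ζ => residueForm (ζ : OnePoint ℂ) f * (w - ζ)⁻¹

/-- The simple polar part of `f` at `ζ` as a rational function; it is zero for `ζ = ∞`. -/
def polarPart (f : RatFunc ℂ) : OnePoint ℂ → RatFunc ℂ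
  | OnePoint.infty => 0
  | OnePoint.some ζ => RatFunc.C (residueForm (ζ : OnePoint ℂ) f) * (RatFunc.X - RatFunc.C ζ)⁻¹

theorem coeff_C_mul (c : ℂ) (x : LaurentSeries ℂ) (k : ℤ) :
    (HahnSeries.C c * x).coeff k = c * x.coeff k := by
  rw [HahnSeries.C_mul_eq_smul, HahnSeries.coeff_smul, smul_eq_mul]

theorem VanishesBelow.C_mul {n : ℤ} {x : LaurentSeries ℂ} (h : VanishesBelow n x) (c : ℂ) :
    VanishesBelow n (HahnSeries.C c * x) := fun k hk => by rw [coeff_C_mul, h k hk, mul_zero]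

theorem vanishesBelow_polarPart (f : RatFunc ℂ) {w : ℂ} {p : OnePoint ℂ} (h : p ≠ w) :
    VanishesBelow 0 (expansion (w : OnePoint ℂ) (polarPart f p)) := by
  induction p using OnePoint.rec with
  | infty => intro k _; simp [polarPart]
  | coe ζ =>
    change VanishesBelow 0 (expansion (w : OnePoint ℂ) (RatFunc.C _ * _))
    rw [map_mul, expansion_C]
    exact (vanishesBelow_linear_inv (fun e => h (by rw [e]))).C_mul _

theorem laurentCoeff_polarPart (f : RatFunc ℂ) {w : ℂ} {p : OnePoint ℂ} (h : p ≠ w) :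
    laurentCoeff (w : OnePoint ℂ) 0 (polarPart f p) = polarTerm f w p := by
  induction p using OnePoint.rec with
  | infty => exact map_zero _
  | coe ζ =>
    change laurentCoeff (w : OnePoint ℂ) 0 (RatFunc.C _ * _) = _
    rw [laurentCoeff_apply, map_mul, expansion_C, coeff_C_mul, ← laurentCoeff_apply,
      laurentCoeff_linear_inv (fun e => h (by rw [e]))]
    rfl

theorem vanishesBelow_infty_linear_inv (a : ℂ) :
    VanishesBelow 1 (expansion OnePoint.infty (RatFunc.X - RatFunc.C a)⁻¹) := by
  rw [expansion_infty_linear_inv]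
  exact .single_mul _ _

theorem coeff_infty_linear_inv (a : ℂ) (k : ℕ) :
    (expansion OnePoint.infty (RatFunc.X - RatFunc.C a)⁻¹).coeff (1 + k) = a ^ k := by
  rw [expansion_infty_linear_inv, VanishesBelow.coeff_single_mul_ofPowerSeries,
    PowerSeries.coeff_mk]

theorem vanishesBelow_infty_polarPart (f : RatFunc ℂ) (p : OnePoint ℂ) :
    VanishesBelow 1 (expansion OnePoint.infty (polarPart f p)) := by
  induction p using OnePoint.rec with
  | infty => intro k _; simp [polarPart]
  | coe ζ =>
    change VanishesBelow 1 (expansion _ (RatFunc.C _ * _))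
    rw [map_mul, expansion_C]
    exact (vanishesBelow_infty_linear_inv ζ).C_mul _

theorem laurentCoeff_zero_algebraMap (w : ℂ) (q : Polynomial ℂ) :
    laurentCoeff (w : OnePoint ℂ) 0 (algebraMap _ (RatFunc ℂ) q) = q.eval w := by
  have := LaurentSeries.coeff_coe_powerSeries (Polynomial.taylor w q : PowerSeries ℂ) 0
  rw [laurentCoeff_apply, expansion_coe_algebraMap]
  simpa using this

/-- The value at `w` of the polynomial part of `f`, for `f` of order at least `-2` at infinity. -/
def polynomialPart (f : RatFunc ℂ) (w : ℂ) : ℂ :=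
  laurentCoeff OnePoint.infty (-2) f * w ^ 2 + laurentCoeff OnePoint.infty (-1) f * w +
    laurentCoeff OnePoint.infty 0 f

/-- Subtracting the simple polar parts leaves no finite pole, hence a polynomial. The polar parts
are `O(u)` at infinity, so its coefficients are those of `f` there, and the bound on the order at
infinity makes its degree at most two. -/
theorem partial_fractions {M : ℕ} {ζ : Fin M → OnePoint ℂ} (hζ : Function.Injective ζ)
    {f : RatFunc ℂ} (hreg : ∀ w : ℂ, (∀ i, ζ i ≠ w) → VanishesBelow 0 (expansion (w : OnePoint ℂ) f))
    (hsimple : ∀ w : ℂ, VanishesBelow (-1) (expansion (w : OnePoint ℂ) f))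
    (hinf : VanishesBelow (-2) (expansion OnePoint.infty f)) {w : ℂ} (hw : ∀ i, ζ i ≠ w) :
    laurentCoeff (w : OnePoint ℂ) 0 f = ∑ i, polarTerm f w (ζ i) + polynomialPart f w := by
  obtain ⟨q, hq⟩ := exists_polynomial_of_regular (f - ∑ i, polarPart f (ζ i)) (by
    intro w
    by_cases h : ∃ j, ζ j = w
    · obtain ⟨j, hj⟩ := h
      -- At `ζ j` only the `j`-th polar part is singular, and it removes the coefficient of degree
      -- `-1`.
      rw [← Finset.add_sum_erase _ _ (Finset.mem_univ j), ← sub_sub, map_sub, map_sum]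
      refine VanishesBelow.sub ?_ (VanishesBelow.sum fun i hi => vanishesBelow_polarPart f ?_)
      · intro k hk
        rw [hj]
        change (expansion (w : OnePoint ℂ) (f - RatFunc.C _ * _)).coeff k = 0
        rw [map_sub, map_mul, expansion_C, HahnSeries.coeff_sub, coeff_C_mul,
          expansion_coe_linear_self_inv, residueForm_coe, HahnSeries.coeff_single]
        split_ifs with h
        · rw [h]; ring
        · rw [hsimple w k (by omega)]; ring
      · rw [← hj]
        exact hζ.ne (Finset.ne_of_mem_erase hi)
    · push Not at h
      rw [map_sub, map_sum]
      exact (hreg w h).sub (VanishesBelow.sum fun i _ => vanishesBelow_polarPart f (h i)))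
  have hcoeff : ∀ k : ℕ, q.coeff k = laurentCoeff OnePoint.infty (-k) f := by
    intro k
    rw [← laurentCoeff_infty_algebraMap, ← hq, map_sub, map_sum, sub_eq_self]
    exact Finset.sum_eq_zero fun i _ => vanishesBelow_infty_polarPart f _ _ (by omega)
  have hdeg : q.natDegree < 3 := by
    rw [Nat.lt_succ_iff, Polynomial.natDegree_le_iff_coeff_eq_zero]
    intro k hk
    rw [hcoeff]
    exact hinf _ (by omega)
  have hval := congrArg (laurentCoeff (w : OnePoint ℂ) 0) hq
  rw [map_sub, map_sum, laurentCoeff_zero_algebraMap, Polynomial.eval_eq_sum_range' hdeg] at hval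
  simp only [Finset.sum_range_succ, Finset.sum_range_zero, hcoeff] at hval
  rw [sub_eq_iff_eq_add] at hval
  rw [hval, Finset.sum_congr rfl fun i _ => laurentCoeff_polarPart f (hw i), polynomialPart]
  push_cast
  simp only [neg_zero]
  ring

/-- Since `1/(z - w) = u + w u² + w² u³ + ⋯`, the coefficient of `u` in the product is the
polynomial part of `f` evaluated at `w`. -/
theorem residueForm_infty_mul_linear_inv {f : RatFunc ℂ}
    (hf : VanishesBelow (-2) (expansion OnePoint.infty f)) (w : ℂ) :
    -residueForm OnePoint.infty (f * (RatFunc.X - RatFunc.C w)⁻¹) = polynomialPart f w := by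
  have h := hf.coeff_mul_two (vanishesBelow_infty_linear_inv w)
  have h0 := coeff_infty_linear_inv w 0
  have h1 := coeff_infty_linear_inv w 1
  have h2 := coeff_infty_linear_inv w 2
  norm_num at h h0 h1 h2
  rw [residueForm_infty, neg_neg, map_mul, map_inv₀, map_sub, h, h0, h1, h2, polynomialPart]
  simp only [laurentCoeff_apply]
  ring

theorem residueForm_coe_mul_linear_inv {f : RatFunc ℂ} {ζ w : ℂ}
    (hf : VanishesBelow (-1) (expansion (ζ : OnePoint ℂ) f)) (h : ζ ≠ w) :
    -residueForm (ζ : OnePoint ℂ) (f * (RatFunc.X - RatFunc.C w)⁻¹) = polarTerm f w ζ := by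
  have h1 := hf.coeff_mul_zero (vanishesBelow_linear_inv h)
  rw [add_zero, ← map_mul, ← laurentCoeff_apply (ζ : OnePoint ℂ) 0, laurentCoeff_linear_inv h] at h1
  change _ = residueForm (ζ : OnePoint ℂ) f * (w - ζ)⁻¹
  rw [residueForm_coe, h1, ← neg_sub w ζ, inv_neg, residueForm_coe]
  ring

/-- Stated as a product so that `w = a` is covered: it then says that `f` vanishes at `a`. This
keeps the sites among the allowed points. -/
theorem mul_laurentCoeff_linear_inv_mul {f : RatFunc ℂ} {a w : ℂ}
    (h : VanishesBelow 0 (expansion (w : OnePoint ℂ) (f * (RatFunc.X - RatFunc.C a)⁻¹))) :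
    (w - a) * laurentCoeff (w : OnePoint ℂ) 0 (f * (RatFunc.X - RatFunc.C a)⁻¹) =
      laurentCoeff (w : OnePoint ℂ) 0 f := by
  have hl : VanishesBelow 0 (expansion (w : OnePoint ℂ) (RatFunc.X - RatFunc.C a)) := by
    rw [expansion_coe_linear]
    exact .ofPowerSeries _
  have h0 : (expansion (w : OnePoint ℂ) (RatFunc.X - RatFunc.C a)).coeff 0 = w - a := by
    rw [expansion_coe_linear]
    simp
  have h1 := h.coeff_mul_zero hl
  rw [add_zero, h0, ← map_mul, inv_mul_cancel_right₀ (X_sub_C_ne_zero a)] at h1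
  rw [laurentCoeff_apply, laurentCoeff_apply, h1, mul_comm]

/-- For `y ≠ 0` the hypotheses say `b q = s / y^(q+1)`, and this is the telescoping sum for `x⁻ʳ⁻¹ -
y⁻ʳ⁻¹`. The recursive form survives at `y = 0`, needed because `y = w - z_α` vanishes at a site. -/
theorem sub_mul_sum_inv_pow_mul {F : Type*} [Field F] {x y s : F} (hx : x ≠ 0) {b : ℕ → F} {r : ℕ}
    (h0 : y * b 0 = s) (hs : ∀ q < r, y * b (q + 1) = b q) :
    (y - x) * ∑ k ∈ Finset.range (r + 1), x⁻¹ ^ (k + 1) * b (r - k) = x⁻¹ ^ (r + 1) * s - b r := by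
  induction r with
  | zero => simp; rw [← h0]; field_simp
  | succ r ih =>
    have ih := ih fun q hq => hs q (by omega)
    have hr := hs r (by omega)
    rw [Finset.sum_range_succ', mul_add]
    have : ∑ k ∈ Finset.range (r + 1), x⁻¹ ^ (k + 1 + 1) * b (r + 1 - (k + 1)) =
        x⁻¹ * ∑ k ∈ Finset.range (r + 1), x⁻¹ ^ (k + 1) * b (r - k) := by
      rw [Finset.mul_sum]
      refine Finset.sum_congr rfl fun k _ => ?_
      rw [Nat.add_sub_add_right]
      ring
    rw [this, mul_left_comm, ih]
    have hxx : x⁻¹ * x = 1 := inv_mul_cancel₀ hx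
    simp only [zero_add, pow_one, Nat.sub_zero]
    linear_combination x⁻¹ * hr - b (r + 1) * hxx

/-! ### The twist function -/

section Twist

variable {S : Type*} (d : SiteData S)

theorem polePart_eq (α : S) (p : ℕ) :
    polePart d α p = (RatFunc.X - RatFunc.C (d.pos α))⁻¹ ^ (p + 1) := by
  rw [polePart, inv_pow]

theorem polePart_zero (α : S) : polePart d α 0 = (RatFunc.X - RatFunc.C (d.pos α))⁻¹ := by
  rw [polePart_eq, zero_add, pow_one]

theorem polePart_succ (α : S) (p : ℕ) : polePart d α (p + 1) =
    polePart d α p * (RatFunc.X - RatFunc.C (d.pos α))⁻¹ := by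
  rw [polePart_eq, polePart_eq, pow_succ _ (p + 1)]

theorem vanishesBelow_polePart {w : ℂ} {α : S} (h : w ≠ d.pos α) (p : ℕ) :
    VanishesBelow 0 (expansion (w : OnePoint ℂ) (polePart d α p)) := by
  induction p with
  | zero => rw [polePart_zero]; exact vanishesBelow_linear_inv h
  | succ p ih =>
    rw [polePart_succ, map_mul]
    exact ih.mul (vanishesBelow_linear_inv h)

theorem expansion_polePart_self (α : S) (p : ℕ) :
    expansion (d.pos α : OnePoint ℂ) (polePart d α p) = HahnSeries.single (-((p : ℤ) + 1)) 1 := by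
  rw [polePart_eq, map_pow, expansion_coe_linear_self_inv, HahnSeries.single_pow]
  simp

theorem vanishesBelow_infty_polePart (α : S) (p : ℕ) :
    VanishesBelow (p + 1) (expansion OnePoint.infty (polePart d α p)) := by
  induction p with
  | zero => rw [polePart_zero]; exact vanishesBelow_infty_linear_inv _
  | succ p ih =>
    rw [polePart_succ, map_mul]
    exact (ih.mul (vanishesBelow_infty_linear_inv _)).mono (by push_cast; rfl)

theorem vanishesBelow_infty_polePart_one (α : S) (p : ℕ) :
    VanishesBelow 1 (expansion OnePoint.infty (polePart d α p)) :=
  (vanishesBelow_infty_polePart d α p).mono (by omega)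

theorem laurentCoeff_infty_one_polePart (α : S) (p : ℕ) :
    laurentCoeff OnePoint.infty 1 (polePart d α p) = if p = 0 then 1 else 0 := by
  split_ifs with h
  · subst h
    rw [polePart_zero]
    simpa [laurentCoeff_apply] using coeff_infty_linear_inv (d.pos α) 0
  · exact vanishesBelow_infty_polePart d α p 1 (by omega)

variable [Fintype S]

theorem laurentCoeff_twist (p : OnePoint ℂ) (k : ℤ) : laurentCoeff p k (twist d) =
    ∑ α, ∑ q : Fin (d.mult α), d.level α q * laurentCoeff p k (polePart d α q) := by
  simp only [twist, map_sum, map_smul, smul_eq_mul]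

/-- Only the top level contributes a pole of order `m_α` at `z_α`. -/
theorem laurentCoeff_twist_pos (α : S) :
    laurentCoeff (d.pos α : OnePoint ℂ) (-d.mult α) (twist d) ≠ 0 := by
  have hpos := d.mult_pos α
  have : laurentCoeff (d.pos α : OnePoint ℂ) (-d.mult α) (twist d) =
      d.level α ⟨d.mult α - 1, Nat.sub_lt (d.mult_pos α) one_pos⟩ := by
    rw [laurentCoeff_twist, Finset.sum_eq_single α]
    · rw [Finset.sum_eq_single ⟨d.mult α - 1, Nat.sub_lt (d.mult_pos α) one_pos⟩]
      · rw [laurentCoeff_apply, expansion_polePart_self, HahnSeries.coeff_single, if_pos, mul_one]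
        simp only
        omega
      · intro q _ hq
        rw [laurentCoeff_apply, expansion_polePart_self, HahnSeries.coeff_single, if_neg, mul_zero]
        intro e
        apply hq
        ext
        simp only
        omega
      · simp
    · intro β _ hβ
      refine Finset.sum_eq_zero fun q _ => ?_
      rw [laurentCoeff_apply, vanishesBelow_polePart d (d.pos_injective.ne hβ.symm) q _ (by omega),
        mul_zero]
    · simp
  rw [this]
  exact d.level_top_ne_zero α

theorem orderTop_twist_pos_le (α : S) :
    (expansion (d.pos α : OnePoint ℂ) (twist d)).orderTop ≤ ((-d.mult α : ℤ) : WithTop ℤ) :=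
  HahnSeries.orderTop_le_of_coeff_ne_zero (laurentCoeff_twist_pos d α)

variable {d}

theorem ne_pos_of_zero {ζ : ℂ} (h : 0 < formOrder (twist d) ζ) (α : S) : ζ ≠ d.pos α := by
  rintro rfl
  have h1 : (0 : WithTop ℤ) < ((-d.mult α : ℤ) : WithTop ℤ) := h.trans_le (orderTop_twist_pos_le d α)
  have : (0 : ℤ) < -d.mult α := by exact_mod_cast h1
  omega

theorem twist_ne_zero (h_simple : ∀ p, formOrder (twist d) p ≤ 1) : twist d ≠ 0 := by
  intro h
  have := h_simple ((0 : ℂ) : OnePoint ℂ)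
  change (expansion ((0 : ℂ) : OnePoint ℂ) (twist d)).orderTop ≤ 1 at this
  rw [h, map_zero, HahnSeries.orderTop_zero] at this
  exact absurd this (by simp)

theorem vanishesBelow_twist_inv (h0 : twist d ≠ 0) {w : ℂ} (hw : ¬ 0 < formOrder (twist d) w) :
    VanishesBelow 0 (expansion (w : OnePoint ℂ) (twist d)⁻¹) := by
  rw [map_inv₀]
  exact (vanishesBelow_inv (n := 0) (expansion_ne_zero _ h0) (not_lt.mp hw)).mono (by omega)

/-! ### Coefficients of the currents in the Lax matrix -/

/-- The scalar coefficient `1 / (φ(z) (z - z_α)^(p+1))` of the current `J^α_p` in `ℒ(z)`. -/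
def laxFunction (d : SiteData S) (α : S) (p : ℕ) : RatFunc ℂ := (twist d)⁻¹ * polePart d α p

/-- At a site the pole of order `p + 1 ≤ m_α` is absorbed by the zero of `1/φ`; elsewhere both
factors are regular. -/
theorem vanishesBelow_laxFunction (h0 : twist d ≠ 0) {w : ℂ} (hw : ¬ 0 < formOrder (twist d) w)
    {α : S} {p : ℕ} (hp : p < d.mult α) :
    VanishesBelow 0 (expansion (w : OnePoint ℂ) (laxFunction d α p)) := by
  rw [laxFunction, map_mul]
  by_cases h : w = d.pos α
  · subst h
    rw [map_inv₀, expansion_polePart_self]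
    exact ((vanishesBelow_inv (expansion_ne_zero _ h0) (orderTop_twist_pos_le d α)).mul
      (vanishesBelow_single _ _)).mono (by omega)
  · exact (vanishesBelow_twist_inv h0 hw).mul (vanishesBelow_polePart d h p)

theorem vanishesBelow_laxFunction_neg_one (h0 : twist d ≠ 0)
    (h_simple : ∀ p, formOrder (twist d) p ≤ 1) (w : ℂ) {α : S} {p : ℕ} (hp : p < d.mult α) :
    VanishesBelow (-1) (expansion (w : OnePoint ℂ) (laxFunction d α p)) := by
  by_cases hw : 0 < formOrder (twist d) w
  · rw [laxFunction, map_mul, map_inv₀]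
    exact (vanishesBelow_inv (n := 1) (expansion_ne_zero _ h0) (h_simple w)).mul
      (vanishesBelow_polePart d (ne_pos_of_zero hw α) p)
  · exact (vanishesBelow_laxFunction h0 hw hp).mono (by omega)

/-- The coefficient of the current `J^α_p` in the Lax matrix `ℒ(w)`. -/
def laxCoeff (d : SiteData S) (w : ℂ) (α : S) (p : ℕ) : ℂ :=
  laurentCoeff (w : OnePoint ℂ) 0 (laxFunction d α p)

theorem mul_laxCoeff_zero (h0 : twist d ≠ 0) {w : ℂ} (hw : ¬ 0 < formOrder (twist d) w) (α : S) :
    (w - d.pos α) * laxCoeff d w α 0 = laurentCoeff (w : OnePoint ℂ) 0 (twist d)⁻¹ := by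
  have h := vanishesBelow_laxFunction h0 hw (d.mult_pos α)
  rw [laxFunction, polePart_zero] at h
  rw [laxCoeff, laxFunction, polePart_zero, mul_laurentCoeff_linear_inv_mul h]

theorem mul_laxCoeff_succ (h0 : twist d ≠ 0) {w : ℂ} (hw : ¬ 0 < formOrder (twist d) w) {α : S}
    {p : ℕ} (hp : p + 1 < d.mult α) : (w - d.pos α) * laxCoeff d w α (p + 1) = laxCoeff d w α p := by
  have h := vanishesBelow_laxFunction h0 hw hp
  rw [laxFunction, polePart_succ, ← mul_assoc] at h
  rw [laxCoeff, laxFunction, polePart_succ, ← mul_assoc, mul_laurentCoeff_linear_inv_mul h]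
  rfl

/-- The constant term of `φ/φ = 1`. It normalises the derivative terms in both Hamiltonian flows. -/
theorem sum_laxCoeff_mul_level (h0 : twist d ≠ 0) (w : ℂ) :
    ∑ α, ∑ q : Fin (d.mult α), laxCoeff d w α q * d.level α q = 1 := by
  have h : (twist d)⁻¹ * twist d = ∑ α, ∑ q : Fin (d.mult α),
      d.level α q • laxFunction d α q := by
    conv_lhs => rw [twist, Finset.mul_sum]
    simp only [Finset.mul_sum, mul_smul_comm, laxFunction]
    rfl
  have h1 := congrArg (laurentCoeff (w : OnePoint ℂ) 0) h
  rw [inv_mul_cancel₀ h0, laurentCoeff_apply, map_one, HahnSeries.coeff_one, if_pos rfl] at h1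
  simp only [map_sum, map_smul, smul_eq_mul] at h1
  rw [h1]
  exact Finset.sum_congr rfl fun α _ => Finset.sum_congr rfl fun q _ => mul_comm _ _

/-- The product of the Gaudin Lax matrix with the value of the Lax matrix at `w`. -/
theorem sum_polePart_mul_laxCoeff (h0 : twist d ≠ 0) {w : ℂ} (hw : ¬ 0 < formOrder (twist d) w)
    {α : S} {r : ℕ} (hr : r < d.mult α) :
    ∑ k ∈ Finset.range (r + 1), laxCoeff d w α (r - k) • polePart d α k =
      (RatFunc.X - RatFunc.C w)⁻¹ * (laxCoeff d w α r • 1 -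
        laurentCoeff (w : OnePoint ℂ) 0 (twist d)⁻¹ • polePart d α r) := by
  have hC : ∀ c : ℂ, ∀ f : RatFunc ℂ, c • f = RatFunc.C c * f := fun c f => by
    rw [Algebra.smul_def]; rfl
  have key := sub_mul_sum_inv_pow_mul (X_sub_C_ne_zero (d.pos α)) (r := r)
    (y := RatFunc.C (w - d.pos α)) (b := fun q => RatFunc.C (laxCoeff d w α q))
    (s := RatFunc.C (laurentCoeff (w : OnePoint ℂ) 0 (twist d)⁻¹))
    (by rw [← map_mul, mul_laxCoeff_zero h0 hw])
    (fun q hq => by rw [← map_mul, mul_laxCoeff_succ h0 hw (by omega)])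
  have hsum : ∑ k ∈ Finset.range (r + 1), laxCoeff d w α (r - k) • polePart d α k =
      ∑ k ∈ Finset.range (r + 1), (RatFunc.X - RatFunc.C (d.pos α))⁻¹ ^ (k + 1) *
        RatFunc.C (laxCoeff d w α (r - k)) :=
    Finset.sum_congr rfl fun k _ => by rw [polePart_eq, hC, mul_comm]
  rw [hsum, eq_inv_mul_iff_mul_eq₀ (X_sub_C_ne_zero w), hC, hC, polePart_eq]
  rw [map_sub] at key
  linear_combination -key

/-- A finite zero of `φ` is not a site, so both factors are regular there; at infinity each is
`O(u)`, so the product is `O(u²)` and has no residue. -/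
theorem residueForm_polePart_mul_linear_inv {p : OnePoint ℂ} (hp : 0 < formOrder (twist d) p)
    {w : ℂ} (hw : p ≠ w) (α : S) (q : ℕ) :
    residueForm p (polePart d α q * (RatFunc.X - RatFunc.C w)⁻¹) = 0 := by
  induction p using OnePoint.rec with
  | infty =>
    rw [residueForm_infty, map_mul, neg_eq_zero]
    exact (vanishesBelow_infty_polePart_one d α q).mul (vanishesBelow_infty_linear_inv w) 1
      (by norm_num)
  | coe ζ =>
    rw [residueForm_coe, map_mul]
    exact (vanishesBelow_polePart d (ne_pos_of_zero hp α) q).mul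
      (vanishesBelow_linear_inv fun e => hw (by rw [e])) (-1) (by norm_num)

/-- Compare constant terms at `ζ` in `φ * laxFunction = polePart`: `φ'(ζ)` times the residue is the
value of the pole part. -/
theorem polarTerm_laxFunction {ζ : ℂ} (hζ : formOrder (twist d) ζ = 1) (w : ℂ) (α : S) (p : ℕ) :
    polarTerm (laxFunction d α p) w ζ = (derivAt 1 (twist d) ζ * (w - ζ))⁻¹ *
      laurentCoeff (ζ : OnePoint ℂ) 0 (polePart d α p) := by
  have hord : (expansion (ζ : OnePoint ℂ) (twist d)).orderTop = ((1 : ℤ) : WithTop ℤ) := hζ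
  have h0 : twist d ≠ 0 := by
    intro h
    rw [h, map_zero, HahnSeries.orderTop_zero] at hord
    exact absurd hord (by simp)
  have hne := HahnSeries.coeff_orderTop_ne hord
  have hφ : VanishesBelow 1 (expansion (ζ : OnePoint ℂ) (twist d)) :=
    vanishesBelow_of_le_orderTop hord.ge
  have hf : VanishesBelow (-1) (expansion (ζ : OnePoint ℂ) (laxFunction d α p)) := by
    rw [laxFunction, map_mul, map_inv₀]
    refine (vanishesBelow_inv (expansion_ne_zero _ h0) hord.le).mul
      (vanishesBelow_polePart d (ne_pos_of_zero ?_ α) p)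
    rw [hζ]; exact one_pos
  have h1 := hφ.coeff_mul_zero hf
  rw [← map_mul, laxFunction, mul_inv_cancel_left₀ h0] at h1
  change (expansion (ζ : OnePoint ℂ) (laxFunction d α p)).coeff (-1) * (w - ζ)⁻¹ = _
  have hd : derivAt 1 (twist d) ζ = (expansion (ζ : OnePoint ℂ) (twist d)).coeff 1 := by
    simp [derivAt, laurentCoeff_apply]
  rw [hd, laurentCoeff_apply]
  rw [show (1 : ℤ) + -1 = 0 by norm_num] at h1
  rw [h1, mul_inv, laxFunction]
  field_simp

/-! ### The twist function at infinity -/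

theorem laurentCoeff_chi_natCast (φ : RatFunc ℂ) (k : ℕ) : derivAt k (chi φ) 0 =
    -(k.factorial * (expansion OnePoint.infty φ).coeff (2 + k)) := by
  rw [derivAt, laurentCoeff_chi, laurentCoeff_apply, add_comm]
  ring

theorem vanishesBelow_infty_of_formOrder {φ : RatFunc ℂ} {n : ℕ}
    (h : formOrder φ OnePoint.infty = (n : ℤ)) :
    VanishesBelow (2 + n) (expansion OnePoint.infty φ) ∧
      (expansion OnePoint.infty φ).coeff (2 + n) ≠ 0 := by
  have hord : (expansion ((0 : ℂ) : OnePoint ℂ) (chi φ)).orderTop = ((n : ℤ) : WithTop ℤ) := h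
  constructor
  · intro k hk
    have := HahnSeries.coeff_eq_zero_of_lt_orderTop (x := expansion ((0 : ℂ) : OnePoint ℂ) (chi φ))
      (i := k - 2) (by rw [hord]; exact WithTop.coe_lt_coe.mpr (by omega))
    rw [← laurentCoeff_apply, laurentCoeff_chi, neg_eq_zero, sub_add_cancel] at this
    exact this
  · have := HahnSeries.coeff_orderTop_ne hord
    rwa [← laurentCoeff_apply, laurentCoeff_chi, neg_ne_zero, add_comm] at this

/-- `1/φ` has order at least `-3` in `u` and pole parts are `O(u)`, so the polynomial part is at
most quadratic. -/
theorem vanishesBelow_infty_laxFunction (h0 : twist d ≠ 0) {n : ℕ}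
    (h : formOrder (twist d) OnePoint.infty = (n : ℤ)) (hn : n ≤ 1) (α : S) (p : ℕ) :
    VanishesBelow (-2) (expansion OnePoint.infty (laxFunction d α p)) := by
  obtain ⟨-, hne⟩ := vanishesBelow_infty_of_formOrder h
  rw [laxFunction, map_mul, map_inv₀]
  exact ((vanishesBelow_inv (expansion_ne_zero _ h0)
    (HahnSeries.orderTop_le_of_coeff_ne_zero hne)).mul
      (vanishesBelow_infty_polePart_one d α p)).mono (by omega)

/-- Multiply the expansions of `1/φ` and of the pole part. The coefficient of `u` in the latter is
the weight of the current in `𝒞`; as `r` is common to all currents, this contribution sums to `r •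
𝒞`. -/
theorem polynomialPart_laxFunction_of_formOrder_eq_zero (h0 : twist d ≠ 0)
    (h : formOrder (twist d) OnePoint.infty = 0) (w : ℂ) : ∃ r : ℂ, ∀ α p,
    polynomialPart (laxFunction d α p) w =
      -(derivAt 0 (chi (twist d)) 0)⁻¹ * laurentCoeff OnePoint.infty 2 (polePart d α p) +
        r * laurentCoeff OnePoint.infty 1 (polePart d α p) := by
  obtain ⟨hv, hne⟩ := vanishesBelow_infty_of_formOrder (n := 0) (by simpa using h)
  have hy : VanishesBelow (-2) (expansion OnePoint.infty (twist d))⁻¹ :=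
    vanishesBelow_inv (expansion_ne_zero _ h0) (by
      simpa using HahnSeries.orderTop_le_of_coeff_ne_zero hne)
  have hy0 := hv.coeff_mul_zero hy
  rw [mul_inv_cancel₀ (expansion_ne_zero _ h0)] at hy0
  have hχ := laurentCoeff_chi_natCast (twist d) 0
  set x := expansion OnePoint.infty (twist d) with hx
  refine ⟨x⁻¹.coeff (-2) * w + x⁻¹.coeff (-1), fun α p => ?_⟩
  have hg := vanishesBelow_infty_polePart_one d α p
  have e2 := hy.mul hg (-2) (by norm_num)
  have e1 := hy.coeff_mul_zero hg
  have e0 := hy.coeff_mul_one hg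
  have hyx : (derivAt 0 (chi (twist d)) 0)⁻¹ = -x⁻¹.coeff (-2) := by
    rw [hχ]
    norm_num at hy0 hne ⊢
    exact inv_eq_of_mul_eq_one_right hy0.symm
  norm_num at e1 e0
  simp only [polynomialPart, laurentCoeff_apply, laxFunction, map_mul, map_inv₀, ← hx, e2, e1, e0,
    hyx]
  ring

theorem polynomialPart_laxFunction_of_formOrder_eq_one (h0 : twist d ≠ 0)
    (h : formOrder (twist d) OnePoint.infty = 1) (w : ℂ) : ∃ r : ℂ, ∀ α p,
    polynomialPart (laxFunction d α p) w =
      -(w / derivAt 1 (chi (twist d)) 0) * laurentCoeff OnePoint.infty 2 (polePart d α p) -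
        (2 * derivAt 1 (chi (twist d)) 0 ^ 2)⁻¹ *
          (2 * derivAt 1 (chi (twist d)) 0 * laurentCoeff OnePoint.infty 3 (polePart d α p) -
            derivAt 2 (chi (twist d)) 0 * laurentCoeff OnePoint.infty 2 (polePart d α p)) +
        r * laurentCoeff OnePoint.infty 1 (polePart d α p) := by
  obtain ⟨hv, hne⟩ := vanishesBelow_infty_of_formOrder (n := 1) (by simpa using h)
  have hy : VanishesBelow (-3) (expansion OnePoint.infty (twist d))⁻¹ :=
    vanishesBelow_inv (expansion_ne_zero _ h0) (by
      simpa using HahnSeries.orderTop_le_of_coeff_ne_zero hne)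
  have hy0 := hv.coeff_mul_zero hy
  have hy1 := hv.coeff_mul_one hy
  rw [mul_inv_cancel₀ (expansion_ne_zero _ h0)] at hy0 hy1
  have hχ1 := laurentCoeff_chi_natCast (twist d) 1
  have hχ2 := laurentCoeff_chi_natCast (twist d) 2
  set x := expansion OnePoint.infty (twist d) with hx
  refine ⟨x⁻¹.coeff (-3) * w ^ 2 + x⁻¹.coeff (-2) * w + x⁻¹.coeff (-1), fun α p => ?_⟩
  have hg := vanishesBelow_infty_polePart_one d α p
  have e2 := hy.coeff_mul_zero hg
  have e1 := hy.coeff_mul_one hg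
  have e0 := hy.coeff_mul_two hg
  norm_num at hy0 hy1 hχ1 hχ2 hne e2 e1 e0
  have hc1 : derivAt 1 (chi (twist d)) 0 ≠ 0 := by rw [hχ1]; exact neg_ne_zero.mpr hne
  -- The two leading coefficients of `1/φ` follow from `x * x⁻¹ = 1` in degrees 0 and 1, where `x₃ =
  -- -χ'(0)` and `x₄ = -χ''(0)/2`.
  have y0 : x⁻¹.coeff (-3) = -(derivAt 1 (chi (twist d)) 0)⁻¹ := by
    rw [hχ1, inv_neg, neg_neg]
    exact (inv_eq_of_mul_eq_one_right hy0.symm).symm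
  have y1 : x⁻¹.coeff (-2) =
      derivAt 2 (chi (twist d)) 0 * (2 * derivAt 1 (chi (twist d)) 0 ^ 2)⁻¹ := by
    rw [y0] at hy1
    have hx3 : x.coeff 3 = -derivAt 1 (chi (twist d)) 0 := by rw [hχ1, neg_neg]
    have hx4 : x.coeff 4 = -(derivAt 2 (chi (twist d)) 0 / 2) := by rw [hχ2]; ring
    rw [hx3, hx4] at hy1
    field_simp at hy1 ⊢
    linear_combination hy1
  simp only [polynomialPart, laurentCoeff_apply, laxFunction, map_mul, map_inv₀, ← hx, e2, e1, e0,
    y0, y1]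
  field_simp
  ring

end Twist

/-! ### Lie algebra valued fields -/

section Fields

variable {𝔤 : Type*} [LieRing 𝔤] [LieAlgebra ℂ 𝔤]
  {V : Type*} [CommRing V] [Algebra ℂ V] {W : Type*} [CommRing W] [Algebra ℂ W]

theorem component_tmul (Y : 𝔤) (v : V) (x : 𝔤) :
    component Y (v ⊗ₜ[ℂ] x) = (-killingForm ℂ 𝔤) x Y • v := by
  rw [component, kappa, LinearMap.BilinForm.baseChange_tmul, mul_one]

/-- `component` as a linear map. -/
def componentHom (Y : 𝔤) : V ⊗[ℂ] 𝔤 →ₗ[ℂ] V :=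
  ((kappa (V := V) (𝔤 := 𝔤)).flip (1 ⊗ₜ[ℂ] Y)).restrictScalars ℂ

theorem component_add (Y : 𝔤) (A B : V ⊗[ℂ] 𝔤) :
    component Y (A + B) = component Y A + component Y B := map_add (componentHom Y) A B

theorem component_neg (Y : 𝔤) (A : V ⊗[ℂ] 𝔤) : component Y (-A) = -component Y A :=
  map_neg (componentHom Y) A

theorem component_zero (Y : 𝔤) : component Y (0 : V ⊗[ℂ] 𝔤) = 0 := map_zero (componentHom Y)

theorem component_smul (Y : 𝔤) (c : ℂ) (A : V ⊗[ℂ] 𝔤) : component Y (c • A) = c • component Y A :=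
  map_smul (componentHom Y) c A

theorem component_sum {ι : Type*} (s : Finset ι) (Y : 𝔤) (A : ι → V ⊗[ℂ] 𝔤) :
    component Y (∑ i ∈ s, A i) = ∑ i ∈ s, component Y (A i) := map_sum (componentHom Y) A s

theorem component_rTensor (f : V →ₗ[ℂ] W) (Y : 𝔤) (A : V ⊗[ℂ] 𝔤) :
    component Y (f.rTensor 𝔤 A) = f (component Y A) := by
  induction A with
  | zero => simp [component_zero]
  | tmul v x => rw [LinearMap.rTensor_tmul, component_tmul, component_tmul, map_smul]
  | add A B hA hB => rw [map_add, component_add, component_add, map_add, hA, hB]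

theorem rTensor_lie (ι : V →ₐ[ℂ] W) (A B : V ⊗[ℂ] 𝔤) :
    ι.toLinearMap.rTensor 𝔤 ⁅A, B⁆ =
      ⁅ι.toLinearMap.rTensor 𝔤 A, ι.toLinearMap.rTensor 𝔤 B⁆ := by
  induction A with
  | zero => simp
  | add A A' hA hA' => simp only [add_lie, map_add, hA, hA']
  | tmul v x =>
    induction B with
    | zero => simp
    | add B B' hB hB' => simp only [lie_add, map_add, hB, hB']
    | tmul v' x' => simp [LieAlgebra.ExtendScalars.bracket_tmul]

theorem complex_smul_lie (c : ℂ) (A B : V ⊗[ℂ] 𝔤) : ⁅c • A, B⁆ = c • ⁅A, B⁆ := by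
  rw [← algebraMap_smul V c A, ← algebraMap_smul V c ⁅A, B⁆, smul_lie]

theorem complex_lie_smul (c : ℂ) (A B : V ⊗[ℂ] 𝔤) : ⁅A, c • B⁆ = c • ⁅A, B⁆ := by
  rw [← algebraMap_smul V c B, ← algebraMap_smul V c ⁅A, B⁆, lie_smul]

/-- Exchanging the indices changes the sign. Applied under a residue, this is `[Γ(z), Γ(z)] = 0`. -/
theorem sum_sum_smul_lie_eq_zero {ι : Type*} [Fintype ι] {c : ι → ι → ℂ}
    (hc : ∀ i j, c i j = c j i) (A : ι → V ⊗[ℂ] 𝔤) : ∑ i, ∑ j, c i j • ⁅A i, A j⁆ = 0 := by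
  have h : ∑ i, ∑ j, c i j • ⁅A i, A j⁆ = -∑ i, ∑ j, c i j • ⁅A i, A j⁆ := by
    conv_lhs => rw [Finset.sum_comm]
    simp only [← Finset.sum_neg_distrib]
    refine Finset.sum_congr rfl fun i _ => Finset.sum_congr rfl fun j _ => ?_
    rw [hc, ← lie_skew, smul_neg]
  have h2 : (2 : ℂ) • ∑ i, ∑ j, c i j • ⁅A i, A j⁆ = 0 := by
    rw [two_smul]
    nth_rewrite 1 [h]
    exact neg_add_cancel _
  exact (smul_eq_zero_iff_right two_ne_zero).mp h2

theorem neg_killingForm_symm (x y : 𝔤) :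
    (-killingForm ℂ 𝔤) x y = (-killingForm ℂ 𝔤) y x := by
  simp only [LinearMap.neg_apply, LieModule.traceForm_comm ℂ 𝔤 𝔤 x y]

theorem neg_killingForm_lie (x y z : 𝔤) :
    (-killingForm ℂ 𝔤) ⁅x, y⁆ z = (-killingForm ℂ 𝔤) x ⁅y, z⁆ := by
  simp only [LinearMap.neg_apply, LieModule.traceForm_apply_lie_apply]

variable [FiniteDimensional ℂ 𝔤] [LieAlgebra.IsSemisimple ℂ 𝔤]
  {n : ℕ} (I : Module.Basis (Fin n) ℂ 𝔤)

variable (𝔤) in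
theorem neg_killingForm_nondegenerate :
    LinearMap.BilinForm.Nondegenerate (-killingForm ℂ 𝔤) := by
  obtain ⟨h1, h2⟩ := LieAlgebra.IsKilling.killingForm_nondegenerate ℂ 𝔤
  exact ⟨fun x hx => h1 x fun y => neg_eq_zero.mp (hx y),
    fun x hx => h2 x fun y => neg_eq_zero.mp (hx y)⟩

/-- The basis dual to `I` with respect to `κ`. -/
def dualBasis : Module.Basis (Fin n) ℂ 𝔤 :=
  LinearMap.BilinForm.dualBasis (-killingForm ℂ 𝔤) (neg_killingForm_nondegenerate 𝔤) I

/-- Completeness relation for the split Casimir `∑ I a ⊗ dualBasis I a`; the next lemma uses its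
other leg. -/
theorem sum_killing_smul_dualBasis (x : 𝔤) :
    ∑ a, (-killingForm ℂ 𝔤) x (I a) • dualBasis I a = x := by
  conv_rhs => rw [← (dualBasis I).sum_repr x]
  exact Finset.sum_congr rfl fun a _ => by
    rw [dualBasis, LinearMap.BilinForm.dualBasis_repr_apply]

theorem sum_killing_dualBasis_smul (x : 𝔤) :
    ∑ a, (-killingForm ℂ 𝔤) x (dualBasis I a) • I a = x := by
  have h : ∀ a, (-killingForm ℂ 𝔤) x (dualBasis I a) = I.repr x a := by
    intro a
    conv_lhs => rw [← I.sum_repr x]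
    rw [map_sum, LinearMap.sum_apply]
    simp only [map_smul, LinearMap.smul_apply]
    rw [Finset.sum_eq_single a]
    · rw [neg_killingForm_symm, dualBasis, LinearMap.BilinForm.apply_dualBasis_left]
      simp
    · intro b _ hb
      rw [neg_killingForm_symm, dualBasis, LinearMap.BilinForm.apply_dualBasis_left, if_neg hb,
        smul_zero]
    · simp
  simp only [h, I.sum_repr]

theorem sum_component_dualBasis_tmul (A : V ⊗[ℂ] 𝔤) :
    ∑ a, component (dualBasis I a) A ⊗ₜ[ℂ] I a = A := by
  induction A with
  | zero => simp [component_zero]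
  | add A B hA hB =>
    simp only [component_add, TensorProduct.add_tmul, Finset.sum_add_distrib, hA, hB]
  | tmul v x =>
    simp only [component_tmul, TensorProduct.smul_tmul, ← TensorProduct.tmul_sum,
      sum_killing_dualBasis_smul]

theorem sum_component_tmul_dualBasis (A : V ⊗[ℂ] 𝔤) :
    ∑ a, component (I a) A ⊗ₜ[ℂ] dualBasis I a = A := by
  induction A with
  | zero => simp [component_zero]
  | add A B hA hB =>
    simp only [component_add, TensorProduct.add_tmul, Finset.sum_add_distrib, hA, hB]
  | tmul v x =>
    simp only [component_tmul, TensorProduct.smul_tmul, ← TensorProduct.tmul_sum,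
      sum_killing_smul_dualBasis]

include I in
theorem component_ext {A B : V ⊗[ℂ] 𝔤} (h : ∀ Y, component Y A = component Y B) : A = B := by
  rw [← sum_component_dualBasis_tmul I A, ← sum_component_dualBasis_tmul I B]
  simp only [h]

/-- Turns `∫ κ(A, B)` into a sum of integrals of products of fields, to which the Leibniz rule
applies. -/
theorem kappa_eq_sum (A B : V ⊗[ℂ] 𝔤) :
    kappa A B = ∑ a, component (I a) A * component (dualBasis I a) B := by
  induction A with
  | zero => simp [component_zero]
  | add A A' hA hA' =>
    simp only [map_add, LinearMap.add_apply, component_add, add_mul, Finset.sum_add_distrib, hA,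
      hA']
  | tmul v x =>
    induction B with
    | zero => simp [component_zero]
    | add B B' hB hB' =>
      simp only [map_add, component_add, mul_add, Finset.sum_add_distrib, hB, hB']
    | tmul v' y =>
      simp only [component_tmul, kappa, LinearMap.BilinForm.baseChange_tmul, smul_mul_smul_comm,
        ← Finset.sum_smul]
      congr 1
      conv_lhs => rw [← sum_killing_smul_dualBasis I x]
      rw [map_sum, LinearMap.sum_apply]
      simp only [map_smul, LinearMap.smul_apply, smul_eq_mul]
      exact Finset.sum_congr rfl fun a _ => by rw [neg_killingForm_symm y]

/-- Completeness contracts the sum to `κ(A, [Z, B])`; invariance of `κ` then moves the bracket onto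
the fields. -/
theorem sum_component_lie_mul (Z : 𝔤) (A B : V ⊗[ℂ] 𝔤) :
    ∑ a, component ⁅Z, I a⁆ A * component (dualBasis I a) B = component Z ⁅B, A⁆ := by
  induction A with
  | zero => simp [component_zero]
  | add A A' hA hA' =>
    simp only [lie_add, component_add, add_mul, Finset.sum_add_distrib, hA, hA']
  | tmul v x =>
    induction B with
    | zero => simp [component_zero]
    | add B B' hB hB' =>
      simp only [add_lie, component_add, mul_add, Finset.sum_add_distrib, hB, hB']
    | tmul v' y =>
      simp only [component_tmul, LieAlgebra.ExtendScalars.bracket_tmul, smul_mul_smul_comm,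
        ← Finset.sum_smul]
      rw [mul_comm v]
      congr 1
      rw [neg_killingForm_symm, ← neg_killingForm_lie]
      conv_rhs => rw [← sum_killing_dualBasis_smul I y]
      rw [lie_sum, map_sum, LinearMap.sum_apply]
      simp only [lie_smul, map_smul, LinearMap.smul_apply, smul_eq_mul]
      exact Finset.sum_congr rfl fun a _ => by rw [neg_killingForm_symm x, mul_comm]

theorem sum_component_mul_lie (Z : 𝔤) (A B : V ⊗[ℂ] 𝔤) :
    ∑ a, component (I a) A * component ⁅Z, dualBasis I a⁆ B = component Z ⁅A, B⁆ := by
  induction A with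
  | zero => simp [component_zero]
  | add A A' hA hA' =>
    simp only [add_lie, component_add, add_mul, Finset.sum_add_distrib, hA, hA']
  | tmul v x =>
    induction B with
    | zero => simp [component_zero]
    | add B B' hB hB' =>
      simp only [lie_add, component_add, mul_add, Finset.sum_add_distrib, hB, hB']
    | tmul v' y =>
      simp only [component_tmul, LieAlgebra.ExtendScalars.bracket_tmul, smul_mul_smul_comm,
        ← Finset.sum_smul]
      congr 1
      rw [neg_killingForm_symm, ← neg_killingForm_lie]
      conv_rhs => rw [← sum_killing_smul_dualBasis I x]
      rw [lie_sum, map_sum, LinearMap.sum_apply]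
      simp only [lie_smul, map_smul, LinearMap.smul_apply, smul_eq_mul]
      exact Finset.sum_congr rfl fun a _ => by rw [neg_killingForm_symm y]

theorem sum_killing_smul_component_dualBasis (Z : 𝔤) (A : V ⊗[ℂ] 𝔤) :
    ∑ a, (-killingForm ℂ 𝔤) Z (I a) • component (dualBasis I a) A = component Z A := by
  conv_rhs => rw [← sum_component_dualBasis_tmul I A, component_sum]
  exact Finset.sum_congr rfl fun a _ => by rw [component_tmul, neg_killingForm_symm]

theorem sum_killing_dualBasis_smul_component (Z : 𝔤) (A : V ⊗[ℂ] 𝔤) :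
    ∑ a, (-killingForm ℂ 𝔤) Z (dualBasis I a) • component (I a) A = component Z A := by
  conv_rhs => rw [← sum_component_tmul_dualBasis I A, component_sum]
  exact Finset.sum_congr rfl fun a _ => by rw [component_tmul, neg_killingForm_symm]

end Fields

/-! ### Weak equality -/

section Weak

variable {𝔤 : Type*} [LieRing 𝔤] [LieAlgebra ℂ 𝔤] {W : Type*} [CommRing W] [Algebra ℂ W]

theorem weakEq_iff_sub {K : Ideal W} {F G : W ⊗[ℂ] 𝔤} : WeakEq K F G ↔ WeakEq K (F - G) 0 := by
  rw [WeakEq, WeakEq, map_sub, map_zero, sub_eq_zero]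

theorem weakEq_smul_zero {K : Ideal W} {F : W ⊗[ℂ] 𝔤} (h : WeakEq K F 0) (c : ℂ) :
    WeakEq K (c • F) 0 := by
  rw [WeakEq, map_zero] at h ⊢
  rw [map_smul, h, smul_zero]

theorem weakEq_rTensor_zero {V : Type*} [AddCommGroup V] [Module ℂ V] {K : Ideal W}
    {f : V →ₗ[ℂ] W} (h : ∀ a, f a ∈ K) (F : V ⊗[ℂ] 𝔤) : WeakEq K (f.rTensor 𝔤 F) 0 := by
  rw [WeakEq, map_zero, ← LinearMap.comp_apply, ← LinearMap.rTensor_comp]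
  have : (Ideal.Quotient.mkₐ ℂ K).toLinearMap ∘ₗ f = 0 :=
    LinearMap.ext fun a => Ideal.Quotient.eq_zero_iff_mem.mpr (h a)
  rw [this, LinearMap.rTensor_zero, LinearMap.zero_apply]

theorem weakEq_zero_of_component_mem [FiniteDimensional ℂ 𝔤] [LieAlgebra.IsSemisimple ℂ 𝔤] {n : ℕ}
    (I : Module.Basis (Fin n) ℂ 𝔤) {K : Ideal W} {F : W ⊗[ℂ] 𝔤}
    (h : ∀ a, component (I a) F ∈ K) : WeakEq K F 0 := by
  rw [WeakEq, map_zero, ← sum_component_tmul_dualBasis I F, map_sum]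
  refine Finset.sum_eq_zero fun a _ => ?_
  rw [LinearMap.rTensor_tmul]
  have : (Ideal.Quotient.mkₐ ℂ K).toLinearMap (component (I a) F) = 0 :=
    Ideal.Quotient.eq_zero_iff_mem.mpr (h a)
  rw [this, TensorProduct.zero_tmul]

theorem mem_constraintIdeal (dx : Derivation ℂ W W) {n : ℕ} (c : Fin n → W) (a : Fin n) :
    c a ∈ constraintIdeal dx c := Ideal.subset_span ⟨a, 0, rfl⟩

end Weak

/-! ### Brackets with products of currents -/

theorem polynomial_sum_linear {V E : Type*} [CommRing V] [AddCommMonoid E] (u v : V)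
    (f : ℕ → V → E) (hf : ∀ n, f n 0 = 0) :
    (Polynomial.C u + Polynomial.C v * Polynomial.X).sum f = f 0 u + f 1 v := by
  have hdeg : (Polynomial.C u + Polynomial.C v * Polynomial.X).natDegree < 2 := by
    rw [add_comm]
    exact Nat.lt_succ_of_le Polynomial.natDegree_linear_le
  rw [Polynomial.sum_over_range' _ hf 2 hdeg]
  simp [Finset.sum_range_succ]

section Bracket

variable {V : Type*} [CommRing V] [Algebra ℂ V] (P : LocalPoissonAlgebra V)

theorem functionalBracket_integral (a b : V) :
    functionalBracket P (integral P a) b = (P.bracket a b).coeff 0 := rfl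

/-- The Leibniz rule gives `{c_λ ab} = c₀ + c₁ λ`, and skew-symmetry turns this at `λ = 0` into `-c₀
+ ∂c₁`. The coefficients `r`, `s` are constants, so `∂` passes through them. -/
theorem functionalBracket_integral_mul {a b c p q : V} {r s : ℂ}
    (ha : P.bracket c a = Polynomial.C p + Polynomial.C (algebraMap ℂ V r) * Polynomial.X)
    (hb : P.bracket c b = Polynomial.C q + Polynomial.C (algebraMap ℂ V s) * Polynomial.X) :
    functionalBracket P (integral P (a * b)) c =
      -(p * b + a * q) + (r • P.der b + s • P.der a) := by
  have h : P.bracket c (a * b) = Polynomial.C (p * b + a * q) +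
      Polynomial.C (r • b + s • a) * Polynomial.X := by
    rw [P.bracket_mul, ha, hb, Algebra.smul_def, Algebra.smul_def]
    simp only [map_add, map_mul]
    ring
  rw [functionalBracket_integral, P.bracket_skew, h, polynomial_sum_linear]
  · simp
    ring
  · intro n
    simp [iterate_map_zero]

end Bracket

/-! ### Currents indexed by sites and orders -/

section Model

variable {S : Type*} {d : SiteData S}

/-- Extension by zero to all orders of a family indexed by the poles. -/
def extendOrder {E : Type*} [Zero E] (Y : (Σ α, Fin (d.mult α)) → E) (α : S) (q : ℕ) : E :=
  if h : q < d.mult α then Y ⟨α, ⟨q, h⟩⟩ else 0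

open Classical in
/-- The member of the family `Y` at the product of two poles in the truncated polynomial algebra:
orders add up, products of distinct sites and products beyond the multiplicity are zero. -/
def siteProduct {E : Type*} [Zero E] (Y : (Σ α, Fin (d.mult α)) → E)
    (k m : Σ α, Fin (d.mult α)) : E :=
  if k.1 = m.1 then extendOrder Y k.1 (k.2 + m.2) else 0

variable [Fintype S]

/-- Collect the pairs at each site by total order; orders beyond the multiplicity contribute zero.
-/
theorem sum_sum_siteProduct {E : Type*} [AddCommGroup E] [Module ℂ E]
    (Y : (Σ α, Fin (d.mult α)) → E) (c : S → ℕ → ℕ → ℂ) :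
    ∑ k : Σ α, Fin (d.mult α), ∑ m : Σ α, Fin (d.mult α), c k.1 k.2 m.2 • siteProduct Y m k =
      ∑ j : Σ α, Fin (d.mult α),
        (∑ q ∈ Finset.range (j.2 + 1), c j.1 q (j.2 - q)) • Y j := by
  classical
  rw [Fintype.sum_sigma, Fintype.sum_sigma]
  refine Finset.sum_congr rfl fun α _ => ?_
  have h1 : ∀ p : Fin (d.mult α), (∑ m : Σ α, Fin (d.mult α),
      c α p m.2 • siteProduct Y m ⟨α, p⟩) =
        ∑ q ∈ Finset.range (d.mult α - p), c α p q • extendOrder Y α (p + q) := by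
    intro p
    rw [Fintype.sum_sigma, Finset.sum_eq_single α]
    · simp only [siteProduct, if_true]
      rw [Fin.sum_univ_eq_sum_range (fun q => c α p q • extendOrder Y α (q + p)),
        ← Finset.sum_subset (Finset.range_subset_range.mpr (Nat.sub_le (d.mult α) p))]
      · exact Finset.sum_congr rfl fun q _ => by rw [add_comm]
      · intro q _ hq
        rw [Finset.mem_range] at hq
        rw [extendOrder, dif_neg (by omega), smul_zero]
    · intro β _ hβ
      exact Finset.sum_eq_zero fun q _ => by rw [siteProduct, if_neg hβ, smul_zero]
    · simp
  simp only [h1]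
  rw [Fin.sum_univ_eq_sum_range (fun p => ∑ q ∈ Finset.range (d.mult α - p),
    c α p q • extendOrder Y α (p + q)), ← Finset.sum_range_diag_flip, ← Fin.sum_univ_eq_sum_range
      (fun r => ∑ q ∈ Finset.range (r + 1), c α q (r - q) • extendOrder Y α (q + (r - q)))]
  refine Finset.sum_congr rfl fun r _ => ?_
  rw [Finset.sum_smul]
  refine Finset.sum_congr rfl fun q hq => ?_
  rw [Finset.mem_range] at hq
  rw [show q + ((r : ℕ) - q) = r by omega, extendOrder, dif_pos r.2]

/-- Contraction of the products with the value of the Lax matrix at `w`. -/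
theorem sum_sum_laxCoeff_siteProduct (h0 : twist d ≠ 0) {w : ℂ}
    (hw : ¬ 0 < formOrder (twist d) w) {E : Type*} [AddCommGroup E] [Module ℂ E]
    (Y : (Σ α, Fin (d.mult α)) → E) (f : RatFunc ℂ →ₗ[ℂ] ℂ) :
    ∑ k : Σ α, Fin (d.mult α), f (polePart d k.1 k.2) •
        ∑ m : Σ α, Fin (d.mult α), laxCoeff d w m.1 m.2 • siteProduct Y m k =
      ∑ j : Σ α, Fin (d.mult α), f ((RatFunc.X - RatFunc.C w)⁻¹ * (laxCoeff d w j.1 j.2 • 1 -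
        laurentCoeff (w : OnePoint ℂ) 0 (twist d)⁻¹ • polePart d j.1 j.2)) • Y j := by
  have h := sum_sum_siteProduct Y fun α p q => f (polePart d α p) * laxCoeff d w α q
  -- Only pairs at one site contribute, so the site of `k` may replace that of `m`, as
  -- `sum_sum_siteProduct` requires.
  have hl : ∀ k m : Σ α, Fin (d.mult α), laxCoeff d w m.1 m.2 • siteProduct Y m k =
      laxCoeff d w k.1 m.2 • siteProduct Y m k := by
    intro k m
    by_cases e : m.1 = k.1
    · obtain ⟨α, p⟩ := k
      obtain ⟨β, q⟩ := m
      subst e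
      rfl
    · rw [siteProduct, if_neg e, smul_zero, smul_zero]
  simp only [Finset.smul_sum, hl, smul_smul]
  rw [h]
  refine Finset.sum_congr rfl fun j _ => ?_
  rw [← sum_polePart_mul_laxCoeff h0 hw j.2.2, map_sum]
  simp only [map_smul, smul_eq_mul, mul_comm]

variable {V : Type*} [CommRing V] [Algebra ℂ V] {P : LocalPoissonAlgebra V}
  {𝔤 : Type*} [LieRing 𝔤] [LieAlgebra ℂ 𝔤] (R : TakiffRealisation d P 𝔤)

namespace TakiffRealisation

/-- The currents as a family indexed by the poles. -/
def currents (k : Σ α, Fin (d.mult α)) : V ⊗[ℂ] 𝔤 := R.current k.1 k.2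

-- Since `siteProduct` vanishes for distinct sites and excessive orders, all cases of the Takiff
-- relations become one polynomial linear in `λ`.
omit [Fintype S] in
theorem bracket_currents (k m : Σ α, Fin (d.mult α)) (Y Z : 𝔤) :
    P.bracket (component Y (R.currents k)) (component Z (R.currents m)) =
      Polynomial.C (component ⁅Y, Z⁆ (siteProduct R.currents k m)) +
        Polynomial.C (algebraMap ℂ V (siteProduct (fun k => d.level k.1 k.2) k m *
          (-killingForm ℂ 𝔤) Y Z)) * Polynomial.X := by
  obtain ⟨α, p⟩ := k
  obtain ⟨β, q⟩ := m
  by_cases h : α = β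
  · subst h
    have := R.bracket_same_site α p q Y Z
    simp only [siteProduct, if_true, extendOrder, currents]
    rw [this]
    split_ifs
    · rfl
    · simp [component_zero]
  · simp only [siteProduct, if_neg h, currents]
    rw [R.bracket_distinct_sites α β p q Y Z h]
    simp [component_zero]

theorem gaudinLax_eq : R.gaudinLax =
    ∑ k : Σ α, Fin (d.mult α), polePart d k.1 k.2 ⊗ₜ[ℂ] R.currents k := by
  rw [Fintype.sum_sigma]
  rfl

theorem valuedCoeff_tmul {E : Type*} [AddCommGroup E] [Module ℂ E] (p : OnePoint ℂ) (k : ℤ)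
    (f : RatFunc ℂ) (x : E) : valuedCoeff p k (f ⊗ₜ[ℂ] x) = laurentCoeff p k f • x := by
  simp [valuedCoeff]

theorem valuedCoeff_gaudinLax (p : OnePoint ℂ) (n : ℤ) : valuedCoeff p n R.gaudinLax =
    ∑ k : Σ α, Fin (d.mult α), laurentCoeff p n (polePart d k.1 k.2) • R.currents k := by
  simp only [gaudinLax_eq, map_sum, valuedCoeff_tmul]

theorem value_lax (w : ℂ) : value R.lax w =
    ∑ k : Σ α, Fin (d.mult α), laxCoeff d w k.1 k.2 • R.currents k := by
  rw [value, lax, gaudinLax_eq, Finset.smul_sum, map_sum]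
  exact Finset.sum_congr rfl fun k _ => by
    rw [TensorProduct.smul_tmul', valuedCoeff_tmul]; rfl

theorem constraint_eq : R.constraint =
    ∑ k : Σ α, Fin (d.mult α), laurentCoeff OnePoint.infty 1 (polePart d k.1 k.2) •
      R.currents k := by
  rw [← valuedCoeff_gaudinLax]
  exact neg_neg _

theorem residue_quadraticCharge (p : OnePoint ℂ) : residue R.quadraticCharge p =
    ∑ k : Σ α, Fin (d.mult α), ∑ l : Σ α, Fin (d.mult α),
      residueForm p (-(2 * twist d)⁻¹ * (polePart d k.1 k.2 * polePart d l.1 l.2)) •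
        integralKappa P (R.currents k) (R.currents l) := by
  have h : R.quadraticCharge = ∑ k : Σ α, Fin (d.mult α), ∑ l : Σ α, Fin (d.mult α),
      (-(2 * twist d)⁻¹ * (polePart d k.1 k.2 * polePart d l.1 l.2)) ⊗ₜ[ℂ]
        integralKappa P (R.currents k) (R.currents l) := by
    rw [quadraticCharge, gaudinLax_eq]
    simp only [map_sum, LinearMap.sum_apply, Finset.smul_sum, TensorProduct.map₂_apply_tmul]
    rw [Finset.sum_comm]
    rfl
  rw [h]
  induction p using OnePoint.rec with
  | infty =>
    change -valuedCoeff _ _ _ = _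
    simp only [map_sum, valuedCoeff_tmul, ← Finset.sum_neg_distrib, ← neg_smul]
    rfl
  | coe w =>
    change valuedCoeff _ _ _ = _
    simp only [map_sum, valuedCoeff_tmul]
    rfl

/-! ### Flow of the quadratic charges -/

variable [FiniteDimensional ℂ 𝔤] [LieAlgebra.IsSemisimple ℂ 𝔤] {n : ℕ}
  (I : Module.Basis (Fin n) ℂ 𝔤)

omit [Fintype S] in
/-- The flow generated by `∫ dx κ(J_k, J_l)` on the currents. -/
theorem functionalBracket_integralKappa_currents (k l m : Σ α, Fin (d.mult α)) :
    (functionalBracket P (integralKappa P (R.currents k) (R.currents l))).rTensor 𝔤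
        (R.currents m) =
      (⁅siteProduct R.currents m k, R.currents l⁆ +
        siteProduct (fun k => d.level k.1 k.2) m k •
          (P.der : V →ₗ[ℂ] V).rTensor 𝔤 (R.currents l)) +
      (⁅siteProduct R.currents m l, R.currents k⁆ +
        siteProduct (fun k => d.level k.1 k.2) m l •
          (P.der : V →ₗ[ℂ] V).rTensor 𝔤 (R.currents k)) := by
  let I := Module.finBasis ℂ 𝔤
  refine component_ext I fun Z => ?_
  have hint : integralKappa P (R.currents k) (R.currents l) =
      ∑ a, integral P (component (I a) (R.currents k) *
        component (dualBasis I a) (R.currents l)) := by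
    rw [← map_sum, ← kappa_eq_sum]
    rfl
  have hterm := fun a => functionalBracket_integral_mul P
    (R.bracket_currents m k Z (I a)) (R.bracket_currents m l Z (dualBasis I a))
  rw [component_rTensor, hint, map_sum, LinearMap.sum_apply]
  simp only [hterm, Finset.sum_add_distrib, Finset.sum_neg_distrib, component_add, component_smul,
    component_rTensor]
  rw [sum_component_lie_mul, sum_component_mul_lie, ← lie_skew (R.currents l),
    ← lie_skew (R.currents k), component_neg, component_neg]
  simp only [mul_smul, ← Finset.smul_sum]
  have e1 : ∑ a, (-killingForm ℂ 𝔤) Z (I a) •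
      P.der (component (dualBasis I a) (R.currents l)) = P.der (component Z (R.currents l)) := by
    conv_rhs => rw [← sum_killing_smul_component_dualBasis I Z (R.currents l), map_sum]
    exact Finset.sum_congr rfl fun a _ => (P.der.map_smul _ _).symm
  have e2 : ∑ a, (-killingForm ℂ 𝔤) Z (dualBasis I a) •
      P.der (component (I a) (R.currents k)) = P.der (component Z (R.currents k)) := by
    conv_rhs => rw [← sum_killing_dualBasis_smul_component I Z (R.currents k), map_sum]
    exact Finset.sum_congr rfl fun a _ => (P.der.map_smul _ _).symm
  rw [e1, e2]
  change _ = _ + _ • P.der _ + (_ + _ • P.der _)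
  abel

/-- The residue at `p` of `ℒ(z) dz / (w - z)`. -/
def residueLax (w : ℂ) (p : OnePoint ℂ) : V ⊗[ℂ] 𝔤 :=
  ∑ l : Σ α, Fin (d.mult α),
    (-residueForm p (laxFunction d l.1 l.2 * (RatFunc.X - RatFunc.C w)⁻¹)) • R.currents l

/-- The flow generated by a residue of the quadratic charge at a zero of the twist function. -/
theorem functionalBracket_residue_quadraticCharge (h0 : twist d ≠ 0) {p : OnePoint ℂ}
    (hp : 0 < formOrder (twist d) p) {w : ℂ} (hw : ¬ 0 < formOrder (twist d) w) :
    (functionalBracket P (residue R.quadraticCharge p)).rTensor 𝔤 (value R.lax w) =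
      (P.der : V →ₗ[ℂ] V).rTensor 𝔤 (R.residueLax w p) +
        ⁅value R.lax w, R.residueLax w p⁆ := by
  have hpw : p ≠ w := by rintro rfl; exact hw hp
  set D := (P.der : V →ₗ[ℂ] V).rTensor 𝔤 with hD
  set lev : (Σ α, Fin (d.mult α)) → ℂ := fun k => d.level k.1 k.2 with hlev
  set u : RatFunc ℂ := (RatFunc.X - RatFunc.C w)⁻¹ with hu
  set s : ℂ := laurentCoeff (w : OnePoint ℂ) 0 (twist d)⁻¹ with hs
  let b : (Σ α, Fin (d.mult α)) → ℂ := fun k => laxCoeff d w k.1 k.2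
  let g : (Σ α, Fin (d.mult α)) → RatFunc ℂ := fun k => polePart d k.1 k.2
  let f : (Σ α, Fin (d.mult α)) → RatFunc ℂ →ₗ[ℂ] ℂ := fun l =>
    residueForm p ∘ₗ LinearMap.mulLeft ℂ (-laxFunction d l.1 l.2)
  let c : (Σ α, Fin (d.mult α)) → (Σ α, Fin (d.mult α)) → ℂ := fun k l =>
    residueForm p (-(2 * twist d)⁻¹ * (g k * g l))
  -- The half of the flow of `∫ κ(J_k, J_l)` on `ℒ(w)` in which `J_k` is bracketed and `J_l` is a
  -- spectator.
  let T : (Σ α, Fin (d.mult α)) → (Σ α, Fin (d.mult α)) → V ⊗[ℂ] 𝔤 := fun k l =>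
    ⁅∑ m, b m • siteProduct R.currents m k, R.currents l⁆ +
      (∑ m, b m • siteProduct lev m k) • D (R.currents l)
  have hsymm : ∀ k l, c k l = c l k := fun k l => by simp only [c, mul_comm (g k)]
  -- The factor `1/2` of the charge cancels against the two equal halves.
  have h2c : ∀ k l, c k l + c k l = f l (g k) := by
    intro k l
    rw [← map_add]
    change residueForm p _ = residueForm p (-(laxFunction d l.1 l.2) * g k)
    congr 1
    rw [laxFunction, mul_inv]
    change -(2⁻¹ * (twist d)⁻¹) * (g k * g l) + -(2⁻¹ * (twist d)⁻¹) * (g k * g l) =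
      -((twist d)⁻¹ * g l) * g k
    have : (2 : RatFunc ℂ)⁻¹ + 2⁻¹ = 1 := by
      have h2 : (2 : RatFunc ℂ) ≠ 0 := two_ne_zero
      field_simp
      norm_num
    linear_combination -(twist d)⁻¹ * g k * g l * this
  have hflow : (functionalBracket P (residue R.quadraticCharge p)).rTensor 𝔤 (value R.lax w) =
      ∑ k, ∑ l, c k l • (T k l + T l k) := by
    change (LinearMap.rTensorHom 𝔤 ∘ₗ functionalBracket P) _ _ = _
    rw [residue_quadraticCharge, map_sum, LinearMap.sum_apply]
    refine Finset.sum_congr rfl fun k _ => ?_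
    rw [map_sum, LinearMap.sum_apply]
    refine Finset.sum_congr rfl fun l _ => ?_
    rw [map_smul, LinearMap.smul_apply]
    congr 1
    rw [value_lax, map_sum]
    have := fun m => R.functionalBracket_integralKappa_currents k l m
    change ∀ m, (LinearMap.rTensorHom 𝔤 ∘ₗ functionalBracket P)
      (integralKappa P (R.currents k) (R.currents l)) (R.currents m) = _ at this
    simp only [map_smul, this, T, sum_lie, complex_smul_lie, Finset.sum_smul, smul_add,
      Finset.sum_add_distrib, smul_assoc, b]
    rfl
  have hsum : ∑ k, ∑ l, c k l • (T k l + T l k) = ∑ l, ∑ k, f l (g k) • T k l := by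
    have h1 : ∑ k, ∑ l, c k l • T l k = ∑ k, ∑ l, c k l • T k l := by
      rw [Finset.sum_comm]
      exact Finset.sum_congr rfl fun k _ => Finset.sum_congr rfl fun l _ => by rw [hsymm]
    simp only [smul_add, Finset.sum_add_distrib]
    rw [h1, ← Finset.sum_add_distrib, Finset.sum_comm (γ := Σ α, Fin (d.mult α)) (f := fun l k =>
      f l (g k) • T k l)]
    refine Finset.sum_congr rfl fun k _ => ?_
    rw [← Finset.sum_add_distrib]
    exact Finset.sum_congr rfl fun l _ => by rw [← add_smul, h2c]
  have hfu : ∀ l j, f l (u * (b j • 1 - s • g j)) = b j * f l u - s * f l (u * g j) := by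
    intro l j
    rw [mul_sub, map_sub, mul_smul_comm, mul_smul_comm, mul_one, map_smul, map_smul, smul_eq_mul,
      smul_eq_mul]
  -- The levels resum to `φ(z)`, which cancels `1/φ(z)` and leaves a form without residue at `p`.
  have hfφ : ∀ l, ∑ j, f l (u * g j) * lev j = 0 := by
    intro l
    have h1 : ∑ j, f l (u * g j) * lev j = f l (u * twist d) := by
      rw [twist, ← Fintype.sum_sigma' (fun α p => d.level α p • polePart d α p), Finset.mul_sum,
        map_sum]
      exact Finset.sum_congr rfl fun j _ => by
        rw [mul_smul_comm, map_smul, smul_eq_mul, mul_comm]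
    have h2 : -laxFunction d l.1 l.2 * (u * twist d) = -(polePart d l.1 l.2 * u) := by
      rw [laxFunction]
      linear_combination -(polePart d l.1 l.2 * u) * inv_mul_cancel₀ h0
    rw [h1]
    change residueForm p (-laxFunction d l.1 l.2 * (u * twist d)) = 0
    rw [h2, map_neg, residueForm_polePart_mul_linear_inv hp hpw, neg_zero]
  have hblev : ∑ j, b j * lev j = 1 := by
    rw [Fintype.sum_sigma]
    exact sum_laxCoeff_mul_level h0 w
  have hanti : ∑ l, ∑ j, f l (u * g j) • ⁅R.currents j, R.currents l⁆ = 0 := by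
    rw [Finset.sum_comm]
    refine sum_sum_smul_lie_eq_zero (c := fun j l => f l (u * g j)) (fun j l => ?_) R.currents
    change residueForm p (-((twist d)⁻¹ * g l) * (u * g j)) =
      residueForm p (-((twist d)⁻¹ * g j) * (u * g l))
    congr 1
    ring
  -- Insert the contraction identities. The last term cancels only after summation over `l`, by
  -- `hanti`.
  have hT : ∀ l, ∑ k, f l (g k) • T k l = f l u • (⁅value R.lax w, R.currents l⁆ +
      D (R.currents l)) - s • ∑ j, f l (u * g j) • ⁅R.currents j, R.currents l⁆ := by
    intro l
    have e1 := sum_sum_laxCoeff_siteProduct h0 hw R.currents (f l)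
    have e2 := sum_sum_laxCoeff_siteProduct h0 hw lev (f l)
    have e3 : ∑ k, f l (g k) • T k l = ⁅∑ k, f l (g k) • ∑ m, b m • siteProduct R.currents m k,
        R.currents l⁆ + (∑ k, f l (g k) • ∑ m, b m • siteProduct lev m k) • D (R.currents l) := by
      simp only [T, smul_add, Finset.sum_add_distrib, sum_lie, complex_smul_lie, Finset.sum_smul,
        smul_assoc]
    rw [e3, e1, e2]
    change ⁅∑ j, f l (u * (b j • 1 - s • g j)) • R.currents j, R.currents l⁆ +
      (∑ j, f l (u * (b j • 1 - s • g j)) • lev j) • D (R.currents l) = _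
    simp only [hfu]
    have e4 : ∑ j, (b j * f l u - s * f l (u * g j)) • lev j = f l u := by
      simp only [smul_eq_mul, sub_mul, Finset.sum_sub_distrib, mul_assoc, ← Finset.mul_sum, hfφ]
      simp only [mul_left_comm (b _), ← Finset.mul_sum, hblev]
      ring
    rw [e4, value_lax]
    simp only [sub_smul, Finset.sum_sub_distrib, sub_lie, sum_lie, complex_smul_lie, smul_add,
      Finset.smul_sum, smul_smul]
    simp only [mul_comm (f l u)]
    abel
  rw [hflow, hsum, Finset.sum_congr rfl fun l _ => hT l, Finset.sum_sub_distrib,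
    ← Finset.smul_sum, hanti, smul_zero, sub_zero, residueLax, lie_sum, map_sum,
    ← Finset.sum_add_distrib]
  refine Finset.sum_congr rfl fun l _ => ?_
  have : -residueForm p (laxFunction d l.1 l.2 * u) = f l u := by
    change _ = residueForm p (-laxFunction d l.1 l.2 * u)
    rw [neg_mul, map_neg]
  rw [this, map_smul, complex_lie_smul, smul_add, add_comm]

end TakiffRealisation

end Model

section Model

variable {S : Type*} [Fintype S] {d : SiteData S}
  {V : Type*} [CommRing V] [Algebra ℂ V] {P : LocalPoissonAlgebra V}
  {𝔤 : Type*} [LieRing 𝔤] [LieAlgebra ℂ 𝔤] (R : TakiffRealisation d P 𝔤)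

namespace TakiffRealisation

/-! ### Partial fractions of the Lax matrix -/

theorem residueLax_coe {ζ w : ℂ} (hζ : formOrder (twist d) ζ = 1) (h0 : twist d ≠ 0)
    (h_simple : ∀ p, formOrder (twist d) p ≤ 1) (h : ζ ≠ w) :
    R.residueLax w ζ = R.poleTerm w ζ := by
  change _ = (derivAt 1 (twist d) ζ * (w - ζ))⁻¹ • value R.gaudinLax ζ
  rw [residueLax, value, valuedCoeff_gaudinLax, Finset.smul_sum]
  refine Finset.sum_congr rfl fun l _ => ?_
  rw [residueForm_coe_mul_linear_inv (vanishesBelow_laxFunction_neg_one h0 h_simple ζ l.2.2) h,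
    polarTerm_laxFunction hζ, mul_smul]

/-- The polynomial part of the Lax matrix at `w`. -/
def polynomialLax (w : ℂ) : V ⊗[ℂ] 𝔤 :=
  ∑ l : Σ α, Fin (d.mult α), polynomialPart (laxFunction d l.1 l.2) w • R.currents l

theorem residueLax_infty (h0 : twist d ≠ 0) (h : formOrder (twist d) OnePoint.infty = 1) (w : ℂ) :
    R.residueLax w OnePoint.infty = R.polynomialLax w :=
  Finset.sum_congr rfl fun l _ => by
    rw [residueForm_infty_mul_linear_inv
      (vanishesBelow_infty_laxFunction h0 (n := 1) (by simpa using h) le_rfl l.1 l.2)]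

theorem sum_polarTerm_smul_currents {p : OnePoint ℂ} (hp : formOrder (twist d) p = 1) (w : ℂ) :
    ∑ l : Σ α, Fin (d.mult α), polarTerm (laxFunction d l.1 l.2) w p • R.currents l =
      R.poleTerm w p := by
  induction p using OnePoint.rec with
  | infty =>
    change ∑ l : Σ α, Fin (d.mult α), (0 : ℂ) • R.currents l = 0
    simp
  | coe ζ =>
    change _ = (derivAt 1 (twist d) ζ * (w - ζ))⁻¹ • value R.gaudinLax ζ
    rw [value, valuedCoeff_gaudinLax, Finset.smul_sum]
    exact Finset.sum_congr rfl fun l _ => by rw [polarTerm_laxFunction hp, mul_smul]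

theorem value_lax_eq_sum_poleTerm (h0 : twist d ≠ 0) (h_simple : ∀ p, formOrder (twist d) p ≤ 1)
    {M : ℕ} {ζ : Fin M → OnePoint ℂ} (hζ_inj : Function.Injective ζ)
    (hζ : ∀ p, (∃ i, ζ i = p) ↔ 0 < formOrder (twist d) p)
    (hζ1 : ∀ i, formOrder (twist d) (ζ i) = 1) {n : ℕ} (hn : n ≤ 1)
    (h : formOrder (twist d) OnePoint.infty = (n : ℤ)) {w : ℂ} (hw : ∀ i, ζ i ≠ w) :
    value R.lax w = ∑ i, R.poleTerm w (ζ i) + R.polynomialLax w := by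
  have hl : ∀ l : Σ α, Fin (d.mult α), laxCoeff d w l.1 l.2 =
      ∑ i, polarTerm (laxFunction d l.1 l.2) w (ζ i) +
        polynomialPart (laxFunction d l.1 l.2) w := by
    intro l
    refine partial_fractions hζ_inj (fun z hz => ?_)
      (fun z => vanishesBelow_laxFunction_neg_one h0 h_simple z l.2.2)
      (vanishesBelow_infty_laxFunction h0 h hn l.1 l.2) hw
    refine vanishesBelow_laxFunction h0 (fun hpos => ?_) l.2.2
    obtain ⟨i, hi⟩ := (hζ z).mpr hpos
    exact hz i hi
  rw [value_lax]
  simp only [hl, add_smul, Finset.sum_add_distrib, Finset.sum_smul]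
  rw [Finset.sum_comm, Finset.sum_congr rfl fun i _ => R.sum_polarTerm_smul_currents (hζ1 i) w]
  rfl

theorem polynomialLax_of_formOrder_eq_zero (h0 : twist d ≠ 0)
    (h : formOrder (twist d) OnePoint.infty = 0) (w : ℂ) : ∃ r : ℂ,
    R.polynomialLax w = (derivAt 0 (chi (twist d)) 0)⁻¹ • R.currentB + r • R.constraint := by
  obtain ⟨r, hr⟩ := polynomialPart_laxFunction_of_formOrder_eq_zero h0 h w
  refine ⟨r, ?_⟩
  simp only [polynomialLax, hr, currentB, constraint_eq, valuedCoeff_gaudinLax, add_smul, mul_smul,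
    Finset.sum_add_distrib, ← Finset.smul_sum, neg_mul, neg_smul, smul_neg,
    Finset.sum_neg_distrib]

theorem polynomialLax_of_formOrder_eq_one (h0 : twist d ≠ 0)
    (h : formOrder (twist d) OnePoint.infty = 1) (w : ℂ) : ∃ r : ℂ,
    R.polynomialLax w = (w / derivAt 1 (chi (twist d)) 0) • R.currentB +
      (2 * derivAt 1 (chi (twist d)) 0 ^ 2)⁻¹ • ((2 * derivAt 1 (chi (twist d)) 0) • R.currentB₁ -
        derivAt 2 (chi (twist d)) 0 • R.currentB) + r • R.constraint := by
  obtain ⟨r, hr⟩ := polynomialPart_laxFunction_of_formOrder_eq_one h0 h w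
  refine ⟨r, ?_⟩
  simp only [polynomialLax, hr, currentB, currentB₁, constraint_eq, valuedCoeff_gaudinLax, add_smul,
    sub_smul, mul_smul, Finset.sum_add_distrib, Finset.sum_sub_distrib, ← Finset.smul_sum, neg_mul,
    neg_smul, smul_neg, smul_sub, Finset.sum_neg_distrib]
  abel

/-! ### The flow generated by the constraint -/

/-- The coefficient of `u` selects order zero at every site, and these elements are the units of the
truncated algebras. -/
theorem sum_laurentCoeff_infty_one_smul_siteProduct {E : Type*} [AddCommGroup E] [Module ℂ E]
    (Y : (Σ α, Fin (d.mult α)) → E) (m : Σ α, Fin (d.mult α)) :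
    ∑ k : Σ α, Fin (d.mult α), laurentCoeff OnePoint.infty 1 (polePart d k.1 k.2) •
      siteProduct Y k m = Y m := by
  obtain ⟨α, q⟩ := m
  rw [Finset.sum_eq_single ⟨α, ⟨0, d.mult_pos α⟩⟩]
  · rw [laurentCoeff_infty_one_polePart, if_pos rfl, one_smul, siteProduct, if_pos rfl, extendOrder,
      dif_pos (by simp)]
    simp
  · rintro ⟨β, p⟩ _ hk
    rw [laurentCoeff_infty_one_polePart]
    split_ifs with hp
    · rw [siteProduct, if_neg, smul_zero]
      rintro e
      apply hk
      simp only at e hp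
      subst e
      congr 1
      exact Fin.ext hp
    · rw [zero_smul]
  · simp

theorem bracket_constraint_currents (m : Σ α, Fin (d.mult α)) (Y Z : 𝔤) :
    P.bracket (component Y R.constraint) (component Z (R.currents m)) =
      Polynomial.C (component ⁅Y, Z⁆ (R.currents m)) +
        Polynomial.C (algebraMap ℂ V (d.level m.1 m.2 * (-killingForm ℂ 𝔤) Y Z)) *
          Polynomial.X := by
  have e1 := sum_laurentCoeff_infty_one_smul_siteProduct R.currents m
  have e2 := sum_laurentCoeff_infty_one_smul_siteProduct (fun k => d.level k.1 k.2) m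
  rw [constraint_eq, component_sum, map_sum, LinearMap.sum_apply]
  conv_rhs => rw [← e1, component_sum, ← e2, Finset.sum_mul, map_sum, map_sum, map_sum,
    Finset.sum_mul, ← Finset.sum_add_distrib]
  refine Finset.sum_congr rfl fun k _ => ?_
  rw [component_smul, map_smul, LinearMap.smul_apply, bracket_currents, component_smul, smul_add,
    Polynomial.smul_C, ← smul_mul_assoc, Polynomial.smul_C, Algebra.smul_def _ (algebraMap ℂ V _),
    ← map_mul, smul_eq_mul, mul_assoc]

theorem component_lie_tmul {W : Type*} [CommRing W] [Algebra ℂ W] (Z : 𝔤) (A : W ⊗[ℂ] 𝔤) (w : W)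
    (x : 𝔤) : component Z ⁅A, w ⊗ₜ[ℂ] x⁆ = w * component ⁅x, Z⁆ A := by
  induction A with
  | zero => simp [component_zero]
  | add A B hA hB => rw [add_lie, component_add, component_add, hA, hB, mul_add]
  | tmul v y =>
    rw [LieAlgebra.ExtendScalars.bracket_tmul, component_tmul, component_tmul, neg_killingForm_lie,
      mul_smul_comm, mul_comm]

variable {W : Type*} [CommRing W] [Algebra ℂ W] (dx : Derivation ℂ W W) (ι : V →ₐ[ℂ] W)

theorem smearedBracket_of_linear {a b u : V} {r : ℂ} (w : W)
    (h : P.bracket a b = Polynomial.C u + Polynomial.C (algebraMap ℂ V r) * Polynomial.X) :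
    smearedBracket P dx ι w a b = w * ι u + r • dx w := by
  change (P.bracket a b).sum (fun n c => dx^[n] w * ι c) = _
  rw [h, polynomial_sum_linear _ _ _ (fun n => by simp)]
  simp [Algebra.smul_def, mul_comm]

variable [FiniteDimensional ℂ 𝔤] [LieAlgebra.IsSemisimple ℂ 𝔤] {n : ℕ}
  (I : Module.Basis (Fin n) ℂ 𝔤)

/-- The constraint acts on a current as an infinitesimal gauge transformation with parameter `μ`,
its inhomogeneous term weighted by the level. -/
theorem sum_smearedBracket_currents (μ : Fin n → W) (m : Σ α, Fin (d.mult α)) :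
    (∑ a, smearedBracket P dx ι (μ a) (R.constraintComponent I a)).rTensor 𝔤 (R.currents m) =
      d.level m.1 m.2 • (dx : W →ₗ[ℂ] W).rTensor 𝔤 (∑ a, μ a ⊗ₜ[ℂ] I a) +
        ⁅ι.toLinearMap.rTensor 𝔤 (R.currents m), ∑ a, μ a ⊗ₜ[ℂ] I a⁆ := by
  refine component_ext I fun Z => ?_
  rw [component_rTensor, LinearMap.sum_apply, lie_sum, map_sum, component_add, component_smul,
    component_sum, component_sum, Finset.smul_sum, ← Finset.sum_add_distrib]
  refine Finset.sum_congr rfl fun a _ => ?_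
  rw [constraintComponent, smearedBracket_of_linear dx ι (μ a)
    (R.bracket_constraint_currents m (I a) Z), component_lie_tmul, LinearMap.rTensor_tmul,
    component_tmul, component_rTensor, smul_smul, add_comm]
  rfl

theorem sum_smearedBracket_value_lax (h0 : twist d ≠ 0) (μ : Fin n → W) (w : ℂ) :
    (∑ a, smearedBracket P dx ι (μ a) (R.constraintComponent I a)).rTensor 𝔤 (value R.lax w) =
      (dx : W →ₗ[ℂ] W).rTensor 𝔤 (∑ a, μ a ⊗ₜ[ℂ] I a) +
        ⁅ι.toLinearMap.rTensor 𝔤 (value R.lax w), ∑ a, μ a ⊗ₜ[ℂ] I a⁆ := by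
  have h1 : ∑ l : Σ α, Fin (d.mult α), laxCoeff d w l.1 l.2 * d.level l.1 l.2 = 1 := by
    rw [Fintype.sum_sigma]
    exact sum_laxCoeff_mul_level h0 w
  have h2 := R.sum_smearedBracket_currents dx ι I μ
  generalize ∑ a, μ a ⊗ₜ[ℂ] I a = ν at h2 ⊢
  rw [value_lax, map_sum, map_sum, sum_lie]
  simp only [map_smul, h2, smul_add, Finset.sum_add_distrib, smul_smul,
    complex_smul_lie]
  rw [← Finset.sum_smul, h1, one_smul]

/-- The zero curvature equation for the flow of the total Hamiltonian. -/
theorem curvature_timeEvolution_eq_zero (h0 : twist d ≠ 0) {M : ℕ} {ζ : Fin M → OnePoint ℂ}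
    (hζ : ∀ p, (∃ i, ζ i = p) ↔ 0 < formOrder (twist d) p) (ε : Fin M → ℂ)
    (hι : ∀ a, ι (P.der a) = dx (ι a)) (μ : Fin n → W) {w : ℂ} (hw : ∀ i, ζ i ≠ w) :
    curvature dx ι (R.timeEvolution dx ι I μ (R.hamiltonian ζ ε))
      (ι.toLinearMap.rTensor 𝔤 (∑ i, ε i • R.residueLax w (ζ i)) + ∑ a, μ a ⊗ₜ[ℂ] I a)
      (value R.lax w) = 0 := by
  have hw' : ¬ 0 < formOrder (twist d) w := fun h => by
    obtain ⟨i, hi⟩ := (hζ w).mpr h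
    exact hw i hi
  have hder : ∀ A : V ⊗[ℂ] 𝔤, (dx : W →ₗ[ℂ] W).rTensor 𝔤 (ι.toLinearMap.rTensor 𝔤 A) =
      ι.toLinearMap.rTensor 𝔤 ((P.der : V →ₗ[ℂ] V).rTensor 𝔤 A) := by
    intro A
    rw [← LinearMap.comp_apply, ← LinearMap.comp_apply, ← LinearMap.rTensor_comp,
      ← LinearMap.rTensor_comp]
    congr 2
    exact LinearMap.ext fun a => (hι a).symm
  have hH : (functionalBracket P (R.hamiltonian ζ ε)).rTensor 𝔤 (value R.lax w) =
      (P.der : V →ₗ[ℂ] V).rTensor 𝔤 (∑ i, ε i • R.residueLax w (ζ i)) +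
        ⁅value R.lax w, ∑ i, ε i • R.residueLax w (ζ i)⁆ := by
    change (LinearMap.rTensorHom 𝔤 ∘ₗ functionalBracket P) _ _ = _
    rw [hamiltonian, map_sum, LinearMap.sum_apply, map_sum, lie_sum, ← Finset.sum_add_distrib]
    refine Finset.sum_congr rfl fun i _ => ?_
    rw [map_smul, LinearMap.smul_apply, map_smul, complex_lie_smul, ← smul_add]
    exact congrArg _
      (R.functionalBracket_residue_quadraticCharge h0 ((hζ _).mp ⟨i, rfl⟩) hw')
  rw [curvature, timeEvolution, LinearMap.rTensor_add, LinearMap.add_apply, LinearMap.rTensor_comp,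
    LinearMap.comp_apply, hH, R.sum_smearedBracket_value_lax dx ι I h0, map_add, map_add, hder,
    rTensor_lie, add_lie,
    ← lie_skew (ι.toLinearMap.rTensor 𝔤 (∑ i, ε i • R.residueLax w (ζ i))),
    ← lie_skew (∑ a, μ a ⊗ₜ[ℂ] I a)]
  abel

end TakiffRealisation

end Model

/-! ### Assembly of the theorem -/

theorem eq_one_of_pos_of_le_one {x : WithTop ℤ} (h : 0 < x) (h' : x ≤ 1) : x = 1 := by
  lift x to ℤ using ne_top_of_le_ne_top (by simp) h'
  norm_cast at h h' ⊢
  omega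

theorem weakEq_constraint_zero {S : Type*} [Fintype S] {d : SiteData S} {V : Type*} [CommRing V]
    [Algebra ℂ V] {P : LocalPoissonAlgebra V} {𝔤 : Type*} [LieRing 𝔤] [LieAlgebra ℂ 𝔤]
    [FiniteDimensional ℂ 𝔤] [LieAlgebra.IsSemisimple ℂ 𝔤] (R : TakiffRealisation d P 𝔤) {n : ℕ}
    (I : Module.Basis (Fin n) ℂ 𝔤) :
    WeakEq (constraintIdeal P.der (R.constraintComponent I)) R.constraint 0 :=
  weakEq_zero_of_component_mem I fun a => mem_constraintIdeal P.der (R.constraintComponent I) a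

theorem weakEq_rTensor_constraint_zero {S : Type*} [Fintype S] {d : SiteData S} {V : Type*}
    [CommRing V] [Algebra ℂ V] {P : LocalPoissonAlgebra V} {𝔤 : Type*} [LieRing 𝔤] [LieAlgebra ℂ 𝔤]
    [FiniteDimensional ℂ 𝔤] [LieAlgebra.IsSemisimple ℂ 𝔤] (R : TakiffRealisation d P 𝔤) {n : ℕ}
    (I : Module.Basis (Fin n) ℂ 𝔤) {W : Type*} [CommRing W] [Algebra ℂ W] (dx : Derivation ℂ W W)
    (ι : V →ₐ[ℂ] W) : WeakEq (constraintIdeal dx fun a => ι (R.constraintComponent I a))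
      (ι.toLinearMap.rTensor 𝔤 R.constraint) 0 :=
  weakEq_zero_of_component_mem I fun a => by
    rw [component_rTensor]
    exact mem_constraintIdeal dx (fun a => ι (R.constraintComponent I a)) a

end Gaudin

end

open scoped TensorProduct in
theorem mainTheorem2
    {𝔤 : Type*} [LieRing 𝔤] [LieAlgebra ℂ 𝔤] [FiniteDimensional ℂ 𝔤]
    [LieAlgebra.IsSemisimple ℂ 𝔤]
    {n : ℕ} (I : Module.Basis (Fin n) ℂ 𝔤)
    -- sites, local fields and Takiff currents
    {S : Type*} [Fintype S] (d : Gaudin.SiteData S)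
    {V : Type*} [CommRing V] [Algebra ℂ V] (P : Gaudin.LocalPoissonAlgebra V)
    (R : Gaudin.TakiffRealisation d P 𝔤)
    -- the 1-form `φ(z) dz` is regular at infinity and has simple zeroes `ζ₁, …, ζ_M`
    (h_regular : 0 ≤ Gaudin.formOrder (Gaudin.twist d) OnePoint.infty)
    (h_simple : ∀ p, Gaudin.formOrder (Gaudin.twist d) p ≤ 1)
    {M : ℕ} (ζ : Fin M → OnePoint ℂ) (hζ_inj : Function.Injective ζ)
    (hζ : ∀ p, (∃ i, ζ i = p) ↔ 0 < Gaudin.formOrder (Gaudin.twist d) p)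
    (ε : Fin M → ℂ)
    -- the differential algebra of the fields and the Lagrange multipliers `μ = μ_a I^a`
    {W : Type*} [CommRing W] [Algebra ℂ W] (dx : Derivation ℂ W W) (ι : V →ₐ[ℂ] W)
    (hι : ∀ a, ι (P.der a) = dx (ι a)) (μ : Fin n → W) :
    let φ := Gaudin.twist d
    let χ := Gaudin.chi φ
    let ℒ : ℂ → V ⊗[ℂ] 𝔤 := Gaudin.value R.lax
    let lift : V ⊗[ℂ] 𝔤 →ₗ[ℂ] W ⊗[ℂ] 𝔤 := ι.toLinearMap.rTensor 𝔤
    let μ' : W ⊗[ℂ] 𝔤 := ∑ a, μ a ⊗ₜ[ℂ] I a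
    let E : V →ₗ[ℂ] W := R.timeEvolution dx ι I μ (R.hamiltonian ζ ε)
    let KV : Ideal V := Gaudin.constraintIdeal P.der (R.constraintComponent I)
    let KW : Ideal W := Gaudin.constraintIdeal dx fun a => ι (R.constraintComponent I a)
    ∃ ℳ : ℂ → W ⊗[ℂ] 𝔤,
      -- zero curvature equation for the flow of the total Hamiltonian
      (∀ z : ℂ, (∀ i, ζ i ≠ z) → Gaudin.curvature dx ι E (ℳ z) (ℒ z) = 0) ∧
      -- hence for every time derivative `∂ₜ` with `∂ₜ𝒪 ≈ {ℋ, 𝒪}`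
      (∀ dt : Derivation ℂ W W, (∀ a, dt (ι a) - E a ∈ KW) → ∀ z : ℂ, (∀ i, ζ i ≠ z) →
        Gaudin.WeakEq KW
          (Gaudin.curvature dx ι ((dt : W →ₗ[ℂ] W) ∘ₗ ι.toLinearMap) (ℳ z) (ℒ z)) 0) ∧
      -- (i) `φ(z) dz` is non-zero at infinity
      (Gaudin.formOrder φ OnePoint.infty = 0 → ∀ z : ℂ, (∀ i, ζ i ≠ z) →
        Gaudin.WeakEq KV (ℒ z)
          (∑ i, R.poleTerm z (ζ i) + (Gaudin.derivAt 0 χ 0)⁻¹ • R.currentB) ∧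
        ℳ z = lift (∑ i, ε i • R.poleTerm z (ζ i)) + μ') ∧
      -- (ii) `φ(z) dz` has a simple zero `ζ_k` at infinity
      (Gaudin.formOrder φ OnePoint.infty = 1 → ∃ k, ζ k = OnePoint.infty ∧
        ∀ z : ℂ, (∀ i, ζ i ≠ z) →
          let χ₁ := Gaudin.derivAt 1 χ 0
          let χ₂ := Gaudin.derivAt 2 χ 0
          let pol : V ⊗[ℂ] 𝔤 := (z / χ₁) • R.currentB +
            (2 * χ₁ ^ 2)⁻¹ • ((2 * χ₁) • R.currentB₁ - χ₂ • R.currentB)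
          Gaudin.WeakEq KV (ℒ z) (∑ i, R.poleTerm z (ζ i) + pol) ∧
          Gaudin.WeakEq KW (ℳ z)
            (lift (∑ i, ε i • R.poleTerm z (ζ i) + ε k • pol) + μ')) := by
  have h0 := Gaudin.twist_ne_zero h_simple
  have hζ1 : ∀ i, Gaudin.formOrder (Gaudin.twist d) (ζ i) = 1 := fun i =>
    Gaudin.eq_one_of_pos_of_le_one ((hζ _).mp ⟨i, rfl⟩) (h_simple _)
  intro φ χ ℒ lift μ' E KV KW
  have hcurv : ∀ z : ℂ, (∀ i, ζ i ≠ z) →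
      Gaudin.curvature dx ι E (lift (∑ i, ε i • R.residueLax z (ζ i)) + μ') (ℒ z) = 0 :=
    fun z hz => R.curvature_timeEvolution_eq_zero dx ι I h0 hζ ε hι μ hz
  refine ⟨fun z => lift (∑ i, ε i • R.residueLax z (ζ i)) + μ', hcurv, ?_, ?_, ?_⟩
  · intro dt hdt z hz
    -- The curvature depends on the time derivative only through its first term, so replacing `E` by
    -- `dt ∘ ι` changes it by `(dt ∘ ι - E)` applied to `ℒ(z)`, which is weakly zero.
    have h := Gaudin.weakEq_rTensor_zero (f := (dt : W →ₗ[ℂ] W) ∘ₗ ι.toLinearMap - E) hdt (ℒ z)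
    rw [LinearMap.rTensor_sub, LinearMap.sub_apply] at h
    have hc := hcurv z hz
    rw [Gaudin.curvature] at hc ⊢
    rw [Gaudin.weakEq_iff_sub, ← hc]
    convert h using 1
    abel
  · intro h z hz
    constructor
    · obtain ⟨r, hr⟩ := R.polynomialLax_of_formOrder_eq_zero h0 h z
      have hL := R.value_lax_eq_sum_poleTerm h0 h_simple hζ_inj hζ hζ1 zero_le_one
        (by simpa using h) hz
      rw [Gaudin.weakEq_iff_sub]
      -- The discrepancy from the stated formula is exactly `r • 𝒞`.
      convert Gaudin.weakEq_smul_zero (Gaudin.weakEq_constraint_zero R I) r using 1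
      change Gaudin.value R.lax z - _ = _
      rw [hL, hr]
      abel
    · have hterm : ∀ i, R.residueLax z (ζ i) = R.poleTerm z (ζ i) := by
        intro i
        have hi := hζ1 i
        have hne := hz i
        revert hi hne
        induction ζ i using OnePoint.rec with
        | infty => intro hi; rw [h] at hi; exact absurd hi zero_ne_one
        | coe w => intro hi hne; exact R.residueLax_coe hi h0 h_simple fun e => hne (by rw [e])
      simp only [hterm]
  · intro h
    obtain ⟨k, hk⟩ := (hζ OnePoint.infty).mpr (by rw [h]; exact one_pos)
    refine ⟨k, hk, fun z hz => ?_⟩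
    obtain ⟨r, hr⟩ := R.polynomialLax_of_formOrder_eq_one h0 h z
    intro χ₁ χ₂ pol
    change R.polynomialLax z = pol + r • R.constraint at hr
    constructor
    · have hL := R.value_lax_eq_sum_poleTerm h0 h_simple hζ_inj hζ hζ1 le_rfl
        (by simpa using h) hz
      rw [Gaudin.weakEq_iff_sub]
      convert Gaudin.weakEq_smul_zero (Gaudin.weakEq_constraint_zero R I) r using 1
      change Gaudin.value R.lax z - _ = _
      rw [hL, hr]
      abel
    · have hterm : ∀ i, i ≠ k → R.residueLax z (ζ i) = R.poleTerm z (ζ i) := by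
        intro i hik
        have hi := hζ1 i
        have hne := hz i
        have hinf : ζ i ≠ OnePoint.infty := fun e => hik (hζ_inj (e.trans hk.symm))
        revert hi hne hinf
        induction ζ i using OnePoint.rec with
        | infty => intro _ _ hinf; exact absurd rfl hinf
        | coe w => intro hi hne _; exact R.residueLax_coe hi h0 h_simple fun e => hne (by rw [e])
      -- The index `k` contributes the polynomial part instead of a pole term; `poleTerm` is zero at
      -- infinity by convention, so the sum on the right may still include `k`.
      have hsum : ∑ i, ε i • R.residueLax z (ζ i) =
          ∑ i, ε i • R.poleTerm z (ζ i) + ε k • pol + (ε k * r) • R.constraint := by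
        rw [← Finset.add_sum_erase _ _ (Finset.mem_univ k),
          ← Finset.add_sum_erase _ (fun i => ε i • R.poleTerm z (ζ i)) (Finset.mem_univ k),
          Finset.sum_congr rfl fun i hi => by rw [hterm i (Finset.ne_of_mem_erase hi)], hk,
          R.residueLax_infty h0 h, hr]
        change _ = ε k • (0 : V ⊗[ℂ] 𝔤) + _ + _ + _
        rw [smul_zero, zero_add, smul_add, mul_smul]
        abel
      rw [Gaudin.weakEq_iff_sub]
      convert Gaudin.weakEq_smul_zero (Gaudin.weakEq_rTensor_constraint_zero R I dx ι)
        (ε k * r) using 1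
      change lift _ + μ' - (lift _ + μ') = (ε k * r) • lift _
      rw [hsum, map_add lift (_ + _), map_smul]
      abel
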